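/- Let $\mathbb{K}$ be a field, $R=\mathbb{K}[x_0,x_1,x_2]$, and let $\mathcal{F}:\mathbb{P}^2_{\mathbb K}\dashrightarrow\mathbb{P}^2_{\mathbb K}$ be a dominant rational map defined by forms $f_0,f_1,f_2\in R$ of the same degree $d\ge 3$. Assume that the base ideal $I=(f_0,f_1,f_2)$ is saturated with respect to $(x_0,x_1,x_2)$ and that $\dim(R/I)=1$. Let $\varphi$ be the $3\times 2$ matrix of a graded (Hilbert--Burch) presentation $$0\to R(-d-\mu_1)\oplus R(-d-\mu_2)\xrightarrow{\ \varphi\ }R(-d)^3\xrightarrow{(f_0,f_1,f_2)} I\to 0,\qquad \mu_1+\mu_2=d,\ \mu_1\le\mu_2,$$ and suppose that $\mu_1=1$. Let $I_1(\varphi)$ be the ideal generated by the entries of $\varphi$. Call a linear change of coordinates in the source and the target (replacing $\varphi$ by $P\,\varphi(Ax)$ with $A,P\in \mathrm{GL}_3(\mathbb{K})$) admissible if it brings $\varphi$ to the form $$\begin{pmatrix} x_0 & p_0\\ -x_1 & p_1\\ 0 & p_2\end{pmatrix}.$$ For a matrix of this form, the Sylvester-form algorithm works in $\mathcal{A}=R[y_0,y_1,y_2]$: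 start with $i=0$ and $F_0=p_0y_0+p_1y_1+p_2y_2$; while $F_i\in(x_0,x_1)$, write $F_i=a_ix_0+b_ix_1$ with $a_i,b_i\in\mathcal{A}$, set $$F_{i+1}=\det\begin{pmatrix} y_0&-y_1\\ a_i&b_i\end{pmatrix},$$ and increase $i$ by one. The number of steps $m$ is the first index with $F_m\notin(x_0,x_1)$. Then $\mathcal{F}$ is birational if and only if both of the following conditions hold: (i) $\operatorname{ht}(I_1(\varphi))=2$; (ii) after an admissible linear change of coordinates, the Sylvester-form algorithm takes exactly $m=d-2$ steps, whatever expressions $F_i=a_ix_0+b_ix_1$ are chosen. The equivalence holds both when (ii) is required for some admissible change of coordinates and when it is required for every admissible change of coordinates. -/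

import Mathlib

/-- The polynomial ring `R = K[x₀, x₁, x₂]`, the homogeneous coordinate ring of `ℙ²`. -/
abbrev PlaneRing (K : Type*) [Field K] := MvPolynomial (Fin 3) K

/-- The polynomial ring `𝒜 = R[y₀, y₁, y₂]`; here `y_i` is `X i` and `x_i` is `C (X i)`. -/
abbrev BiRing (K : Type*) [Field K] := MvPolynomial (Fin 3) (PlaneRing K)

namespace PlaneMap

open MvPolynomial

section
variable {K : Type*} [Field K]

/-- A rational map `ℙ² ⇢ ℙ²` given by the forms `f = (f₀ : f₁ : f₂)` of one degree is dominant when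
its image lies in no hypersurface: no nonzero polynomial in `y₀, y₁, y₂` vanishes at `f`. -/
def IsDominant (f : Fin 3 → PlaneRing K) : Prop :=
  AlgebraicIndependent K f

/-- `f` is birational: it is dominant, and some tuple `g` of forms of one degree defines an inverse
rational map, i.e. both composites are defined and are the identity of `ℙ²`:
`g(f) = D • (x₀, x₁, x₂)` and `f(g) = D' • (y₀, y₁, y₂)` with `D, D' ≠ 0`. -/
def IsBirational (f : Fin 3 → PlaneRing K) : Prop :=
  IsDominant f ∧
    ∃ (e : ℕ) (g : Fin 3 → MvPolynomial (Fin 3) K),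
      (∀ j, (g j).IsHomogeneous e) ∧
      (∃ D : PlaneRing K, D ≠ 0 ∧ ∀ j, aeval f (g j) = D * X j) ∧
      (∃ D' : MvPolynomial (Fin 3) K, D' ≠ 0 ∧ ∀ i, aeval g (f i) = D' * X i)

/-- The base ideal `I = (f₀, f₁, f₂)`. -/
noncomputable def baseIdeal (f : Fin 3 → PlaneRing K) : Ideal (PlaneRing K) :=
  Ideal.span (Set.range f)

/-- The ideal `𝔪 = (x₀, x₁, x₂)`. -/
noncomputable def irrelevantIdeal (K : Type*) [Field K] : Ideal (PlaneRing K) :=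
  Ideal.span (Set.range X)

/-- `I` is saturated: `(I : 𝔪^∞) = I`. -/
def IsSaturated (I : Ideal (PlaneRing K)) : Prop :=
  ∀ (p : PlaneRing K) (n : ℕ), (∀ q ∈ irrelevantIdeal K ^ n, q * p ∈ I) → p ∈ I

/-- `φ` is the matrix of a graded presentation
`0 → R(-d-μ₁) ⊕ R(-d-μ₂) → R(-d)³ → I → 0` of the ideal generated by the forms `f` of degree `d`,
where `μ₁ + μ₂ = d` and `μ₁ ≤ μ₂`. -/
structure IsHilbertBurch (f : Fin 3 → PlaneRing K) (d μ₁ μ₂ : ℕ)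
    (φ : Matrix (Fin 3) (Fin 2) (PlaneRing K)) : Prop where
  sum_eq : μ₁ + μ₂ = d
  le : μ₁ ≤ μ₂
  homogeneous₁ : ∀ i, (φ i 0).IsHomogeneous μ₁
  homogeneous₂ : ∀ i, (φ i 1).IsHomogeneous μ₂
  injective : Function.Injective φ.mulVec
  exact : ∀ v : Fin 3 → PlaneRing K, ∑ i, f i * v i = 0 ↔ ∃ u : Fin 2 → PlaneRing K, φ.mulVec u = v

/-- `I₁(φ)`, the ideal generated by the entries of `φ`. -/
noncomputable def entryIdeal (φ : Matrix (Fin 3) (Fin 2) (PlaneRing K)) : Ideal (PlaneRing K) :=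
  Ideal.span (Set.range fun ij : Fin 3 × Fin 2 => φ ij.1 ij.2)

/-- The linear substitution `x_i ↦ ∑ j, A i j * x_j` in the source. -/
noncomputable def substSource (A : GL (Fin 3) K) : PlaneRing K →ₐ[K] PlaneRing K :=
  aeval fun i => ∑ j, C (A.val i j) * X j

/-- The presentation matrix after linear changes of coordinates in source and target. If the row
`f` of forms satisfies `f φ = 0`, then the row `f(A x) P⁻¹`, which is `f` after the change of
coordinates `A` in the source and `P` in the target, has presentation matrix `P φ(A x)`. -/
noncomputable def changeCoords (A P : GL (Fin 3) K) (φ : Matrix (Fin 3) (Fin 2) (PlaneRing K)) :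
    Matrix (Fin 3) (Fin 2) (PlaneRing K) :=
  Matrix.of fun i k => ∑ j, C (P.val i j) * substSource A (φ j k)

/-- The first column of `φ` is `(x₀, -x₁, 0)`. -/
def IsNormalForm (φ : Matrix (Fin 3) (Fin 2) (PlaneRing K)) : Prop :=
  φ 0 0 = X 0 ∧ φ 1 0 = -X 1 ∧ φ 2 0 = 0

/-- The polynomial `g₂`, second entry of the row `(y₀, y₁, y₂) φ`. -/
noncomputable def secondEquation (φ : Matrix (Fin 3) (Fin 2) (PlaneRing K)) : BiRing K :=
  ∑ i, X i * C (φ i 1)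

/-- The ideal `(x₀, x₁)` of `𝒜`. -/
noncomputable def axisIdeal (K : Type*) [Field K] : Ideal (BiRing K) :=
  Ideal.span {C (X 0), C (X 1)}

/-- `F 0, …, F m` is a complete run of the algorithm of Sylvester forms on a matrix `φ` with first
column `(x₀, -x₁, 0)`. It starts at `F 0 = g₂`; while `F i` lies in `(x₀, x₁)`, one writes
`F i = a x₀ + b x₁` and sets `F (i+1) = det (y₀, -y₁; a, b)`; it stops at the first `F m` outside
`(x₀, x₁)`. (The values of `F` beyond `m` play no role.) -/
def IsSylvesterRun (φ : Matrix (Fin 3) (Fin 2) (PlaneRing K)) (F : ℕ → BiRing K) (m : ℕ) : Prop :=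
  F 0 = secondEquation φ ∧
    (∀ i < m, ∃ a b : BiRing K,
      F i = a * C (X 0) + b * C (X 1) ∧ F (i + 1) = Matrix.det !![X 0, -X 1; a, b]) ∧
    F m ∉ axisIdeal K

/-- The algorithm of Sylvester forms, applied to `φ`, takes exactly `m` steps: it can be run to its
end, and every complete run, whatever expressions `F i = a x₀ + b x₁` are chosen, has `m` steps. -/
def SylvesterSteps (φ : Matrix (Fin 3) (Fin 2) (PlaneRing K)) (m : ℕ) : Prop :=
  (∃ F, IsSylvesterRun φ F m) ∧ ∀ F n, IsSylvesterRun φ F n → n = m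

end

end PlaneMap

/-! ### Polynomial identities used throughout -/

namespace PlaneMap

open MvPolynomial Matrix

/-! The forms are, up to a constant, the maximal minors of `φ` (`exists_eq_C_mul_minors`). Hence,
away from base points, the fibre over a generic point `y` of the target is cut out by the two
entries of `(y₀, y₁, y₂) φ`. As `μ₁ = 1`, the first cuts out a line, and the second restricts to a
polynomial in one variable whose degree decides birationality.

In normal form the line `y₀x₀ = y₁x₁` is parametrized by `(y₁, y₀, s)`, and the restricted equation
is `fiberPolynomial`, called `G` here. If `G` has degree one, solving for `s` yields a rational
inverse (`isBirational_of_natDegree`). Conversely, let `g` be the inverse. Every root of `G` gives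
the point `g(y)`, so there is at most one root. Were the degree at least two, the root would be
multiple, and the differentials of the two equations would be parallel at `g(y)`. Differentiating
the equations of the graph along `g` excludes this, in every characteristic
(`eq_zero_of_differentials_parallel`, `natDegree_lineEquation_le_one`).

The substitution `x₀ = t y₁`, `x₁ = t y₀`, `x₂ = s` turns each Sylvester step into division by `t`.
The number of steps is therefore the order in `t`, which by homogeneity is `μ₂ - deg G`; it equals
`d - 2 = μ₂ - 1` exactly when `deg G = 1` (`sylvesterSteps_iff_natDegree`). Degree one also forces
all `p_i` into `(x₀, x₁)`, which gives the height condition.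

If the linear column cannot be put in normal form, it becomes `(x₀, x₁, x₂)`. The height is then not
two, and the map is not birational: the degree bound would put a point with `x₁ = 0` into the
generic fibre. Base points do not interfere, because they are algebraic over `K`
(`isAlgebraic_div_of_aeval_eq_zero`). -/

/-- A vector orthogonal to `a` and `b` is parallel to their cross product. -/
theorem mul_crossProduct_comm {A : Type*} [CommRing A] {a b y : Fin 3 → A}
    (ha : ∑ i, a i * y i = 0) (hb : ∑ i, b i * y i = 0) (i j : Fin 3) :
    y i * (a ⨯₃ b) j = y j * (a ⨯₃ b) i := by
  rw [Fin.sum_univ_three] at ha hb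
  fin_cases i <;> fin_cases j <;> simp [cross_apply]
  · linear_combination a 2 * hb - b 2 * ha
  · linear_combination b 1 * ha - a 1 * hb
  · linear_combination b 2 * ha - a 2 * hb
  · linear_combination a 0 * hb - b 0 * ha
  · linear_combination a 1 * hb - b 1 * ha
  · linear_combination b 0 * ha - a 0 * hb

/-- The chain rule for a derivation and a polynomial expression. -/
theorem derivation_aeval {K A σ : Type*} [Field K] [CommRing A] [Algebra K A] [Fintype σ]
    (D : Derivation K A A) (g : σ → A) (p : MvPolynomial σ K) :
    D (aeval g p) = ∑ j, aeval g (pderiv j p) * D (g j) := by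
  classical
  induction p using MvPolynomial.induction_on with
  | C a => simp
  | add p q hp hq => simp [hp, hq, add_mul, Finset.sum_add_distrib]
  | mul_X p i hp =>
    simp only [map_mul, aeval_X, Derivation.leibniz, hp, smul_eq_mul, pderiv_X, map_add,
      Pi.single_apply, apply_ite (aeval g), map_zero, mul_ite, mul_one, mul_zero,
      ite_mul, zero_mul, add_mul, Finset.sum_add_distrib, Finset.mul_sum, Finset.sum_ite_eq,
      Finset.mem_univ, if_true]
    congr 1
    exact Finset.sum_congr rfl fun j _ => by ring

theorem aeval_mul_of_isHomogeneous {K A σ : Type*} [Field K] [CommRing A] [Algebra K A]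
    {p : MvPolynomial σ K} {n : ℕ} (hp : p.IsHomogeneous n) (c : A) (u : σ → A) :
    aeval (fun i => c * u i) p = c ^ n * aeval u p := by
  rw [aeval_def, aeval_def, eval₂_eq, eval₂_eq, Finset.mul_sum]
  refine Finset.sum_congr rfl fun m hm => ?_
  have h : ∑ i ∈ m.support, m i = n := (hp.degree_eq_sum_deg_support hm).symm
  simp only [mul_pow, Finset.prod_mul_distrib, Finset.prod_pow_eq_pow_sum, h]
  ring

/-! ### The forms as maximal minors of the presentation matrix -/

section syzygies

variable {K : Type*} [Field K] {d μ₁ μ₂ : ℕ} {f : Fin 3 → PlaneRing K}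
  {φ : Matrix (Fin 3) (Fin 2) (PlaneRing K)}

/-- The vector of signed maximal minors of `φ`. -/
noncomputable def minors (φ : Matrix (Fin 3) (Fin 2) (PlaneRing K)) : Fin 3 → PlaneRing K :=
  (fun i => φ i 0) ⨯₃ (fun i => φ i 1)

theorem IsHilbertBurch.sum_mul_col (h : IsHilbertBurch f d μ₁ μ₂ φ) (k : Fin 2) :
    ∑ i, f i * φ i k = 0 :=
  (h.exact _).2 ⟨Pi.single k 1, by ext1 i; simp⟩

/-- Vanishing minors make the columns parallel, so each `(-φ i 1, φ i 0)` lies in the kernel of `φ`;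
injectivity then kills the first column, and after that `(1, 0)`. -/
theorem IsHilbertBurch.minors_ne_zero (h : IsHilbertBurch f d μ₁ μ₂ φ) : minors φ ≠ 0 := by
  intro h0
  have hpar (i j : Fin 3) : φ i 0 * φ j 1 = φ j 0 * φ i 1 := by
    have h0' := congrFun h0 0
    have h1' := congrFun h0 1
    have h2' := congrFun h0 2
    simp only [minors, cross_apply, cons_val, Pi.zero_apply] at h0' h1' h2'
    fin_cases i <;> fin_cases j <;> simp
    · linear_combination h2'
    · linear_combination -h1'
    · linear_combination -h2'
    · linear_combination h0'
    · linear_combination h1'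
    · linear_combination -h0'
  have key (i : Fin 3) : φ i 0 = 0 := by
    have : φ.mulVec ![-φ i 1, φ i 0] = φ.mulVec 0 := by
      ext1 j
      simp only [mulVec, dotProduct, Fin.sum_univ_two, cons_val]
      simp
      linear_combination hpar i j
    simpa using congrFun (h.injective this) 1
  have : φ.mulVec ![1, 0] = φ.mulVec 0 := by
    ext1 j
    simp [mulVec, dotProduct, Fin.sum_univ_two, key]
  simpa using congrFun (h.injective this) 0

theorem IsHilbertBurch.mul_minors_comm (h : IsHilbertBurch f d μ₁ μ₂ φ) (i j : Fin 3) :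
    f i * minors φ j = f j * minors φ i :=
  mul_crossProduct_comm (by simpa only [mul_comm] using h.sum_mul_col 0)
    (by simpa only [mul_comm] using h.sum_mul_col 1) i j

/-- If the entries of the first column have no common divisor, the same holds for the maximal
minors. -/
theorem IsHilbertBurch.isUnit_of_dvd_minors (h : IsHilbertBurch f d μ₁ μ₂ φ)
    (hl : ∀ e, (∀ i, e ∣ φ i 0) → IsUnit e) {e : PlaneRing K} (he : ∀ i, e ∣ minors φ i) :
    IsUnit e := by
  refine hl e fun k => ?_
  choose δ hδ using he
  have he0 : e ≠ 0 := by
    rintro rfl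
    exact h.minors_ne_zero (funext fun i => by simp [hδ i])
  obtain ⟨i₀, hi₀⟩ : ∃ i, δ i ≠ 0 := by
    by_contra! h0
    exact h.minors_ne_zero (funext fun i => by simp [hδ i, h0 i])
  have hfδ (i j : Fin 3) : f i * δ j = f j * δ i := by
    have := h.mul_minors_comm i j
    rw [hδ i, hδ j] at this
    exact mul_left_cancel₀ he0 (by linear_combination this)
  have hlδ : ∑ i, φ i 0 * δ i = 0 := by
    have h1 : ∑ i, φ i 0 * minors φ i = 0 := dot_self_cross _ _
    refine (mul_eq_zero.1 (?_ : e * _ = 0)).resolve_left he0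
    rw [Finset.mul_sum, ← h1]
    exact Finset.sum_congr rfl fun i _ => by rw [hδ i]; ring
  -- As `f` is parallel to `δ`, the vector `δ × e_k` is a syzygy of `f`, hence a combination of the
  -- columns.
  obtain ⟨u, hu⟩ := (h.exact (δ ⨯₃ (Pi.single k 1))).1 (by
    simp only [cross_apply, Fin.sum_univ_three, cons_val]
    linear_combination (Pi.single k 1 : Fin 3 → PlaneRing K) 2 * hfδ 0 1 +
      (Pi.single k 1 : Fin 3 → PlaneRing K) 0 * hfδ 1 2 -
      (Pi.single k 1 : Fin 3 → PlaneRing K) 1 * hfδ 0 2)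
  have hu' (i : Fin 3) : φ i 0 * u 0 + φ i 1 * u 1 = (δ ⨯₃ (Pi.single k 1)) i := by
    rw [← hu]; simp [mulVec, dotProduct, Fin.sum_univ_two]
  -- Cross the relation with the first column: the triple product formula and `hlδ` leave `φ k 0 •
  -- δ` on one side, and `u 1` times the minors on the other.
  have hm (i : Fin 3) : δ i * (∑ j, φ j 0 * (Pi.single k 1 : Fin 3 → PlaneRing K) j) =
      u 1 * (e * δ i) := by
    rw [← hδ i]
    have e0 := hu' 0
    have e1 := hu' 1
    have e2 := hu' 2
    simp only [Fin.sum_univ_three, cross_apply, cons_val] at *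
    generalize (Pi.single k 1 : Fin 3 → PlaneRing K) = w at *
    simp only [minors, cross_apply]
    fin_cases i <;> simp only [Fin.zero_eta, Fin.mk_one, Fin.reduceFinMk, cons_val]
    · linear_combination w 0 * hlδ + φ 2 0 * e1 - φ 1 0 * e2
    · linear_combination w 1 * hlδ + φ 0 0 * e2 - φ 2 0 * e0
    · linear_combination w 2 * hlδ + φ 1 0 * e0 - φ 0 0 * e1
  refine ⟨u 1, mul_left_cancel₀ hi₀ ?_⟩
  have := hm i₀
  simp only [Pi.single_apply, mul_ite, mul_one, mul_zero, Finset.sum_ite_eq', Finset.mem_univ,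
    if_true] at this
  rw [this]; ring

/-- The forms with presentation matrix `φ` are constant multiples of the maximal minors. -/
theorem IsHilbertBurch.exists_eq_C_mul_minors (h : IsHilbertBurch f d μ₁ μ₂ φ)
    (hf : ∀ i, (f i).IsHomogeneous d) (hf0 : f ≠ 0)
    {i₁ i₂ : Fin 3} (hp : Prime (φ i₁ 0)) (hnd : ¬ φ i₁ 0 ∣ φ i₂ 0) :
    ∃ c : K, c ≠ 0 ∧ ∀ i, f i = C c * minors φ i := by
  have hex (k : Fin 3) : ∃ β, ∀ i, f i * φ k 0 = β * minors φ i := by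
    -- The same triple product argument, applied to the syzygy `f × e_k`.
    obtain ⟨u, hu⟩ := (h.exact (f ⨯₃ (Pi.single k 1))).1 (dot_self_cross _ _)
    have hu' (i : Fin 3) : φ i 0 * u 0 + φ i 1 * u 1 = (f ⨯₃ (Pi.single k 1)) i := by
      rw [← hu]; simp [mulVec, dotProduct, Fin.sum_univ_two]
    refine ⟨u 1, fun i => ?_⟩
    have hl := h.sum_mul_col 0
    have e0 := hu' 0
    have e1 := hu' 1
    have e2 := hu' 2
    have hk : φ k 0 = ∑ j, φ j 0 * (Pi.single k 1 : Fin 3 → PlaneRing K) j := by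
      simp [Pi.single_apply]
    rw [hk]
    simp only [Fin.sum_univ_three, cross_apply, cons_val] at *
    generalize (Pi.single k 1 : Fin 3 → PlaneRing K) = w at *
    simp only [minors, cross_apply]
    fin_cases i <;> simp only [Fin.zero_eta, Fin.mk_one, Fin.reduceFinMk, cons_val]
    · linear_combination w 0 * hl + φ 2 0 * e1 - φ 1 0 * e2
    · linear_combination w 1 * hl + φ 0 0 * e2 - φ 2 0 * e0
    · linear_combination w 2 * hl + φ 1 0 * e0 - φ 0 0 * e1
  choose β hβ using hex
  obtain ⟨j, hj⟩ := Function.ne_iff.1 h.minors_ne_zero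
  have hβl : β i₁ * φ i₂ 0 = β i₂ * φ i₁ 0 :=
    mul_right_cancel₀ hj (by linear_combination φ i₁ 0 * hβ i₂ j - φ i₂ 0 * hβ i₁ j)
  -- Coprimality of two column entries splits off the common factor `c`; comparing degrees then
  -- shows that `c` is constant.
  obtain ⟨c, hc⟩ := (hp.dvd_or_dvd ⟨β i₂, by rw [hβl, mul_comm]⟩).resolve_right hnd
  have hfc (i : Fin 3) : f i = c * minors φ i :=
    mul_right_cancel₀ hp.ne_zero (by rw [hβ i₁ i, hc]; ring)
  obtain ⟨i, hi⟩ := Function.ne_iff.1 hf0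
  have hci : c ≠ 0 := fun h0 => hi (by simp [hfc i, h0])
  have hmi : minors φ i ≠ 0 := fun h0 => hi (by simp [hfc i, h0])
  have hmd : (minors φ i).IsHomogeneous d := by
    have hd := h.sum_eq
    simp only [minors, cross_apply]
    have hh (a b : Fin 3) : (φ a 0 * φ b 1).IsHomogeneous d :=
      hd ▸ (h.homogeneous₁ a).mul (h.homogeneous₂ b)
    fin_cases i <;> exact (hh _ _).sub (hh _ _)
  have htd := totalDegree_mul_of_isDomain hci hmi
  rw [← hfc i, (hf i).totalDegree hi, hmd.totalDegree hmi] at htd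
  obtain ⟨c', rfl⟩ : ∃ c', c = C c' := ⟨_, totalDegree_eq_zero_iff_eq_C.1 (by omega)⟩
  exact ⟨c', fun h0 => hci (by simp [h0]), hfc⟩

end syzygies

/-! ### Base points are algebraic over the ground field -/

/-- A prime ideal of `A[X]` that meets the factorial domain `A` in zero, given here as the kernel of
a homomorphism, is principal: its elements have a common divisor that lies in it. -/
theorem exists_forall_dvd_of_map_eq_zero {A B : Type*} [CommRing A] [IsDomain A]
    [UniqueFactorizationMonoid A] [CommRing B] [IsDomain B] (ψ : Polynomial A →+* B)
    (hψ : Function.Injective (ψ.comp Polynomial.C)) :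
    ∃ q : Polynomial A, ¬ IsUnit q ∧ ∀ h, ψ h = 0 → q ∣ h := by
  classical
  have := UniqueFactorizationMonoid.strongNormalizationMonoid (α := A)
  let := UniqueFactorizationMonoid.toNormalizedGCDMonoid A
  by_cases hbot : RingHom.ker ψ = ⊥
  · refine ⟨0, not_isUnit_zero, fun h hh => ?_⟩
    rw [← RingHom.mem_ker, hbot, Ideal.mem_bot] at hh
    simp [hh]
  have hC {r : A} (hr : ψ (Polynomial.C r) = 0) : r = 0 :=
    hψ (by simpa using hr)
  obtain ⟨q, hq, hqp⟩ := (RingHom.ker_isPrime ψ).exists_mem_prime_of_ne_bot hbot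
  rw [RingHom.mem_ker] at hq
  have hdeg : q.natDegree ≠ 0 := by
    intro h0
    rw [Polynomial.natDegree_eq_zero] at h0
    obtain ⟨c, rfl⟩ := h0
    exact hqp.ne_zero (by simp [hC hq])
  have hprim := hqp.irreducible.isPrimitive hdeg
  refine ⟨q, hqp.not_isUnit, fun h hh => ?_⟩
  have hirr := (hprim.irreducible_iff_irreducible_map_fraction_map (K := FractionRing A)).1
    hqp.irreducible
  refine hprim.dvd_of_fraction_map_dvd_fraction_map (K := FractionRing A) ?_
  by_contra hnd
  -- A Bézout relation over the fraction field, cleared of denominators, would put a nonzero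
  -- constant into the kernel.
  obtain ⟨a, b, hab⟩ := (EuclideanDomain.dvd_or_coprime _ (h.map (algebraMap A (FractionRing A)))
    hirr).resolve_left hnd
  obtain ⟨s, hs, ha⟩ := IsLocalization.integerNormalization_spec (nonZeroDivisors A) a
  obtain ⟨t, ht, hb⟩ := IsLocalization.integerNormalization_spec (nonZeroDivisors A) b
  have hinj := Polynomial.map_injective _ (IsFractionRing.injective A (FractionRing A))
  have key : Polynomial.C t * IsLocalization.integerNormalization (nonZeroDivisors A) a * q +
      Polynomial.C s * IsLocalization.integerNormalization (nonZeroDivisors A) b * h =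
      Polynomial.C (s * t) := by
    apply hinj
    simp only [Polynomial.map_add, Polynomial.map_mul, ha, hb, Polynomial.map_C, map_mul,
      Algebra.smul_def, Polynomial.algebraMap_apply]
    linear_combination Polynomial.C (algebraMap A (FractionRing A) s) *
      Polynomial.C (algebraMap A (FractionRing A) t) * hab
  have := congrArg ψ key
  simp only [map_add, map_mul ψ, hq, hh, mul_zero, add_zero] at this
  exact mul_ne_zero (nonZeroDivisors.ne_zero hs) (nonZeroDivisors.ne_zero ht) (hC this.symm)

/-- The forms in two variables vanish at `(v X, X)` only if they are zero when `v` is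
transcendental. -/
theorem injective_aeval_of_transcendental {K Ω : Type*} [Field K] [Field Ω] [Algebra K Ω]
    {v c : Ω} (hc : c ≠ 0) (hv : Transcendental K v) :
    Function.Injective (aeval (R := K)
      ![Polynomial.C (v * c) * Polynomial.X, Polynomial.C c * (Polynomial.X : Polynomial Ω)]) := by
  rw [injective_iff_map_eq_zero]
  intro r hr
  ext m
  -- The power of `X` isolates one homogeneous part of `r`; within it the exponent of `v` determines
  -- the monomial.
  let s := r.support.filter fun k => k 0 + k 1 = m 0 + m 1
  have hcoeff : Polynomial.aeval v (∑ k ∈ s, Polynomial.monomial (k 0) (coeff k r)) = 0 := by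
    have h := congrArg (fun p => p.coeff (m 0 + m 1)) hr
    simp only [aeval_def, eval₂_eq', Fin.prod_univ_two, cons_val, Polynomial.finsetSum_coeff,
      Polynomial.coeff_zero, mul_pow, ← Polynomial.C_pow,
      IsScalarTower.algebraMap_eq K Ω (Polynomial Ω), Polynomial.algebraMap_eq,
      RingHom.comp_apply] at h
    have h2 (k : Fin 2 →₀ ℕ) : (Polynomial.C (algebraMap K Ω (coeff k r)) *
        (Polynomial.C (v ^ k 0 * c ^ k 0) * Polynomial.X ^ k 0 *
          (Polynomial.C (c ^ k 1) * Polynomial.X ^ k 1))).coeff (m 0 + m 1) =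
        if k 0 + k 1 = m 0 + m 1 then
          c ^ (m 0 + m 1) * (algebraMap K Ω (coeff k r) * v ^ k 0) else 0 := by
      rw [show Polynomial.C (algebraMap K Ω (coeff k r)) *
        (Polynomial.C (v ^ k 0 * c ^ k 0) * Polynomial.X ^ k 0 *
          (Polynomial.C (c ^ k 1) * Polynomial.X ^ k 1)) =
          Polynomial.C (algebraMap K Ω (coeff k r) * (v ^ k 0 * c ^ k 0) * c ^ k 1) *
            Polynomial.X ^ (k 0 + k 1) by simp only [Polynomial.C_mul]; ring,
        Polynomial.coeff_C_mul_X_pow]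
      split_ifs with h1 h2 h2
      · rw [h1]; ring
      · exact absurd h1.symm h2
      · exact absurd h2.symm h1
      · rfl
    simp only [h2, ← Finset.sum_filter] at h
    rw [← Finset.mul_sum] at h
    have h3 := (mul_eq_zero.1 h).resolve_left (pow_ne_zero _ hc)
    simpa [map_sum, Polynomial.aeval_monomial, s] using h3
  have h0 := (transcendental_iff.1 hv) _ hcoeff
  have h1 := congrArg (fun p => p.coeff (m 0)) h0
  simp only [Polynomial.finsetSum_coeff, Polynomial.coeff_monomial, Polynomial.coeff_zero] at h1
  by_cases hm : m ∈ r.support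
  · rw [Finset.sum_eq_single_of_mem m (by simp [s, Finset.mem_filter, mem_support_iff.1 hm])] at h1
    · simpa using h1
    · intro k hk hkm
      rw [if_neg]
      intro h0
      apply hkm
      have := (Finset.mem_filter.1 hk).2
      ext i
      fin_cases i
      · exact h0
      · simp only [Fin.mk_one]; omega
  · simpa using hm

/-- The common zeros of forms `f₀, f₁, f₂` without common divisor are algebraic. -/
theorem isAlgebraic_div_of_aeval_eq_zero {K Ω : Type*} [Field K] [Field Ω] [Algebra K Ω]
    {f : Fin 3 → PlaneRing K} {d : ℕ} (hf : ∀ i, (f i).IsHomogeneous d)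
    (hprim : ∀ e, (∀ i, e ∣ f i) → IsUnit e) {u : Fin 3 → Ω} (hu : ∀ i, aeval u (f i) = 0)
    (j k : Fin 3) (hk : u k ≠ 0) : IsAlgebraic K (u j / u k) := by
  rcases eq_or_ne j k with rfl | hjk
  · rw [div_self hk]; exact isAlgebraic_one
  -- Index `0` is the one that `finSuccEquiv` turns into the polynomial variable, so `x_j` and `x_k`
  -- become coefficients.
  obtain ⟨π, hπj, hπk⟩ : ∃ π : Equiv.Perm (Fin 3), π j = 1 ∧ π k = 2 := by
    clear hk
    revert j k; decide
  by_contra hv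
  let E : PlaneRing K ≃ₐ[K] Polynomial (MvPolynomial (Fin 2) K) :=
    (renameEquiv K π).trans (finSuccEquiv K 2)
  -- The factor `X` moves along the cone over `u`: if `u j / u k` is transcendental, no nonzero
  -- polynomial in `x_j, x_k` vanishes there, and the kernel has a common divisor.
  let Θ : PlaneRing K →ₐ[K] Polynomial Ω := aeval fun i => Polynomial.X * Polynomial.C (u i)
  let ψ : Polynomial (MvPolynomial (Fin 2) K) →+* Polynomial Ω := (Θ.comp E.symm.toAlgHom).toRingHom
  have hE1 : E (X j) = Polynomial.C (X 0) := by
    simp only [E, AlgEquiv.trans_apply, renameEquiv_apply, rename_X, hπj]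
    exact finSuccEquiv_X_succ (j := 0)
  have hE2 : E (X k) = Polynomial.C (X 1) := by
    simp only [E, AlgEquiv.trans_apply, renameEquiv_apply, rename_X, hπk]
    exact finSuccEquiv_X_succ (j := 1)
  have hψ : Function.Injective (ψ.comp Polynomial.C) := by
    have heq : ψ.comp Polynomial.C = (aeval (R := K) ![Polynomial.C (u j / u k * u k) * Polynomial.X,
        Polynomial.C (u k) * (Polynomial.X : Polynomial Ω)]).toRingHom := by
      apply MvPolynomial.ringHom_ext
      · intro r
        have : E.symm (Polynomial.C (C r)) = C r := by
          rw [AlgEquiv.symm_apply_eq]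
          exact (E.commutes r).symm
        simp [ψ, this]
      · intro i
        fin_cases i
        · have : E.symm (Polynomial.C (X 0)) = X j := by rw [← hE1, E.symm_apply_apply]
          change Θ (E.symm (Polynomial.C (X 0))) = aeval _ (X 0)
          rw [this]
          simp only [Θ, aeval_X, div_mul_cancel₀ _ hk]
          exact Polynomial.X_mul_C _
        · have : E.symm (Polynomial.C (X 1)) = X k := by rw [← hE2, E.symm_apply_apply]
          change Θ (E.symm (Polynomial.C (X 1))) = aeval _ (X 1)
          rw [this]
          simp only [Θ, aeval_X]
          exact Polynomial.X_mul_C _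
    rw [heq]
    exact injective_aeval_of_transcendental hk hv
  obtain ⟨q, hq, hqd⟩ := exists_forall_dvd_of_map_eq_zero ψ hψ
  refine hq ?_
  rw [← MulEquiv.isUnit_map E.symm]
  refine hprim _ fun i => ?_
  have h1 : ψ (E (f i)) = 0 := by
    have h2 : Θ (f i) = 0 := by
      simp only [Θ]
      rw [aeval_mul_of_isHomogeneous (hf i) Polynomial.X fun i => Polynomial.C (u i)]
      have : aeval (fun i => Polynomial.C (u i)) (f i) = Polynomial.C (aeval u (f i)) :=
        (aeval_algebraMap_apply (Polynomial Ω) u (f i))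
      rw [this, hu i]; simp
    simpa [ψ] using h2
  obtain ⟨w, hw⟩ := hqd _ h1
  exact ⟨E.symm w, by rw [← map_mul, ← hw, AlgEquiv.symm_apply_apply]⟩

/-- Algebraically independent elements satisfy no linear relation with algebraic coefficients. -/
theorem eq_zero_of_sum_mul_eq_zero {K Ω ι : Type*} [Field K] [Field Ω] [Algebra K Ω] [Fintype ι]
    {y : ι → Ω} (hy : AlgebraicIndependent K y) {u : ι → Ω} (hu : ∀ i, IsAlgebraic K (u i))
    (h : ∑ i, u i * y i = 0) (i : ι) : u i = 0 := by
  have h1 := hy.algebraicClosure.linearIndependent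
  rw [Fintype.linearIndependent_iff] at h1
  have := h1 (fun i => ⟨u i, mem_algebraicClosure_iff'.2 (hu i).isIntegral⟩) (by simpa [Algebra.smul_def] using h) i
  simpa using congrArg Subtype.val this

/-! ### Two-sided inverses from one-sided ones -/

section birational

variable {K : Type*} [Field K] {f : Fin 3 → PlaneRing K} {d : ℕ}

/-- A dominant map with a rational left inverse is birational. -/
theorem IsDominant.isBirational (hdom : IsDominant f) (hf : ∀ i, (f i).IsHomogeneous d)
    {e : ℕ} {g : Fin 3 → MvPolynomial (Fin 3) K} (hg : ∀ j, (g j).IsHomogeneous e)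
    {D : PlaneRing K} (hD : D ≠ 0) (hgf : ∀ j, aeval f (g j) = D * X j) : IsBirational f := by
  refine ⟨hdom, e, g, hg, ⟨D, hD, hgf⟩, ?_⟩
  have hinj : Function.Injective (aeval (R := K) f) := hdom
  have hfg (i : Fin 3) : aeval f (aeval g (f i)) = D ^ d * f i := by
    rw [← AlgHom.comp_apply, comp_aeval]
    simp only [hgf]
    rw [aeval_mul_of_isHomogeneous (hf i) D X, aeval_X_left_apply]
  -- The parallelism of `f(g)` and `y` may be tested after substituting `f`, which is injective by
  -- dominance.
  have hpar (i j : Fin 3) : aeval g (f i) * X j = aeval g (f j) * X i := by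
    apply hinj
    simp only [map_mul, hfg, aeval_X]
    ring
  have hX0 : ¬ (X 0 : MvPolynomial (Fin 3) K) ∣ X 1 := by simp [X_dvd_X]
  obtain ⟨D', hD'⟩ := (X_prime.dvd_or_dvd (⟨aeval g (f 1), by rw [hpar 0 1, mul_comm]⟩ :
    X 0 ∣ aeval g (f 0) * X 1)).resolve_right hX0
  have hD'i (i : Fin 3) : aeval g (f i) = D' * X i :=
    mul_right_cancel₀ (X_ne_zero (0 : Fin 3)) (by rw [hpar i 0, hD']; ring)
  refine ⟨D', fun h0 => ?_, hD'i⟩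
  have h1 := hfg 0
  rw [hD'i 0, h0, zero_mul, map_zero] at h1
  exact mul_ne_zero (pow_ne_zero _ hD) (hdom.ne_zero 0) h1.symm

end birational

/-! ### The generic fibre of a birational map -/

/-- A polynomial of degree at least two over an algebraically closed field with at most one root has
a multiple root. -/
theorem exists_isRoot_derivative {Ω : Type*} [Field Ω] [IsAlgClosed Ω] {G : Polynomial Ω}
    (hdeg : 2 ≤ G.natDegree) (huniq : ∀ s t, G.IsRoot s → G.IsRoot t → s = t) :
    ∃ s, G.IsRoot s ∧ (Polynomial.derivative G).IsRoot s := by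
  obtain ⟨s, hs⟩ := IsAlgClosed.exists_root G fun h => by
    have h0 : G.natDegree = 0 := Polynomial.natDegree_eq_of_degree_eq_some h
    omega
  obtain ⟨H, rfl⟩ := Polynomial.dvd_iff_isRoot.2 hs
  have hH0 : H ≠ 0 := by rintro rfl; simp at hdeg
  have hH : H.natDegree ≠ 0 := by
    rw [Polynomial.natDegree_mul (Polynomial.X_sub_C_ne_zero s) hH0,
      Polynomial.natDegree_X_sub_C] at hdeg
    omega
  obtain ⟨t, ht⟩ := IsAlgClosed.exists_root H
    (fun h => hH (Polynomial.natDegree_eq_of_degree_eq_some h))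
  obtain rfl := huniq s t hs (by simp [Polynomial.IsRoot.def, ht.eq_zero])
  exact ⟨s, hs, by simp [Polynomial.IsRoot.def, ht.eq_zero]⟩

section generic

variable {K : Type*} [Field K] {d μ₁ μ₂ e : ℕ} {f : Fin 3 → PlaneRing K}
  {φ : Matrix (Fin 3) (Fin 2) (PlaneRing K)} {g : Fin 3 → MvPolynomial (Fin 3) K}
  {Ω : Type*} [Field Ω] [Algebra K Ω] {y : Fin 3 → Ω}

theorem aeval_minors (x : Fin 3 → Ω) (j : Fin 3) :
    aeval x (minors φ j) = ((fun i => aeval x (φ i 0)) ⨯₃ (fun i => aeval x (φ i 1))) j := by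
  fin_cases j <;> simp [minors, cross_apply]

/-- The point on the graph over a generic point `y` of the target is the value of the inverse. -/
theorem mul_aeval_inverse_comm (hy : AlgebraicIndependent K y)
    {c : K} (hfc : ∀ i, f i = C c * minors φ i) (hg : ∀ j, (g j).IsHomogeneous e)
    {D : PlaneRing K} (hgf : ∀ j, aeval f (g j) = D * X j) {x : Fin 3 → Ω}
    (h₁ : ∑ i, y i * aeval x (φ i 0) = 0) (h₂ : ∑ i, y i * aeval x (φ i 1) = 0)
    (hx : ∃ i, aeval x (f i) ≠ 0) (i j : Fin 3) :
    x i * aeval y (g j) = x j * aeval y (g i) := by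
  have hpar (i j : Fin 3) : y i * aeval x (f j) = y j * aeval x (f i) := by
    have := mul_crossProduct_comm (a := fun i => aeval x (φ i 0)) (b := fun i => aeval x (φ i 1))
      (y := y) (by simpa only [mul_comm] using h₁) (by simpa only [mul_comm] using h₂) i j
    rw [← aeval_minors, ← aeval_minors] at this
    simp only [hfc, map_mul]
    linear_combination aeval x (C c : PlaneRing K) * this
  have hy0 : y 0 ≠ 0 := hy.ne_zero 0
  set t := aeval x (f 0) / y 0
  have hft (j : Fin 3) : aeval x (f j) = t * y j := by
    have := hpar 0 j
    simp only [t]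
    field_simp
    linear_combination this
  have ht : t ≠ 0 := by
    rintro h0
    obtain ⟨i, hi⟩ := hx
    exact hi (by rw [hft, h0, zero_mul])
  -- Evaluate `g(f) = D • x` at the point, using `f(x) = t y`. Only `t ≠ 0` is needed; `D(x)` may
  -- vanish.
  have key (j : Fin 3) : t ^ e * aeval y (g j) = aeval x D * x j := by
    rw [← aeval_mul_of_isHomogeneous (hg j)]
    simp only [← hft]
    have := congrArg (aeval x) (hgf j)
    rw [← AlgHom.comp_apply, comp_aeval] at this
    simpa using this
  refine mul_left_cancel₀ (pow_ne_zero e ht) ?_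
  linear_combination x i * key j - x j * key i

/-- Substituting `g` in a syzygy and cancelling `D'` shows that the point `(g(y), y)` satisfies both
equations of the graph. -/
theorem IsHilbertBurch.sum_X_mul_aeval (h : IsHilbertBurch f d μ₁ μ₂ φ)
    {D' : MvPolynomial (Fin 3) K} (hD' : D' ≠ 0) (hfg : ∀ i, aeval g (f i) = D' * X i)
    (k : Fin 2) : ∑ i, X i * aeval g (φ i k) = 0 := by
  have := congrArg (aeval g) (h.sum_mul_col k)
  simp only [map_sum, map_mul, hfg, map_zero, mul_assoc] at this
  rw [← Finset.mul_sum] at this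
  exact (mul_eq_zero.1 this).resolve_left hD'

/-- At the generic point of the inverse, the differentials of the two equations of the graph are
linearly independent. -/
theorem IsHilbertBurch.eq_zero_of_differentials_parallel (h : IsHilbertBurch f d μ₁ μ₂ φ)
    (hy : AlgebraicIndependent K y) {c : K} (hfc : ∀ i, f i = C c * minors φ i)
    {D' : MvPolynomial (Fin 3) K} (hD' : D' ≠ 0) (hfg : ∀ i, aeval g (f i) = D' * X i)
    {N : Fin 2 → Fin 3 → Ω}
    (hN : ∀ k j, ∑ i, y i * aeval (fun l => aeval y (g l)) (pderiv j (φ i k)) = N k j)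
    (hpar : ∀ i j, N 1 i * N 0 j = N 1 j * N 0 i) : N 0 = 0 := by
  by_contra hne
  obtain ⟨k, hk⟩ := Function.ne_iff.1 hne
  rw [Pi.zero_apply] at hk
  have hγ (q : PlaneRing K) : aeval y (aeval g q) = aeval (fun l => aeval y (g l)) q := by
    rw [← AlgHom.comp_apply, comp_aeval]
  -- Apply `∂/∂y_m` to the equations of the graph along `g`.
  have hd (m : Fin 3) (k : Fin 2) : aeval (fun l => aeval y (g l)) (φ m k) +
      ∑ j, N k j * aeval y (pderiv m (g j)) = 0 := by
    have h1 := congrArg (fun q => aeval y (pderiv m q)) (h.sum_X_mul_aeval hD' hfg k)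
    simp only [map_sum, Derivation.leibniz, smul_eq_mul, derivation_aeval, map_add, map_mul,
      aeval_X, map_zero, hγ, Finset.sum_add_distrib] at h1
    simp only [pderiv_X, Pi.single_apply, apply_ite (aeval y), map_one, map_zero, mul_ite, mul_one,
      mul_zero, Finset.sum_ite_eq', Finset.mem_univ, if_true] at h1
    rw [← h1, add_comm]
    simp only [← hN, Finset.sum_mul, Finset.mul_sum]
    rw [Finset.sum_comm]
    simp only [mul_assoc]
  -- Parallel differentials eliminate the derivatives of `g`, so the columns of `φ` are parallel at
  -- `g(y)` and the minors vanish there.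
  have hpl (m : Fin 3) : N 0 k * aeval (fun l => aeval y (g l)) (φ m 1) =
      N 1 k * aeval (fun l => aeval y (g l)) (φ m 0) := by
    have h0 := hd m 0
    have h1 := hd m 1
    rw [Fin.sum_univ_three] at h0 h1
    linear_combination N 0 k * h1 - N 1 k * h0 - aeval y (pderiv m (g 0)) * hpar 0 k -
      aeval y (pderiv m (g 1)) * hpar 1 k - aeval y (pderiv m (g 2)) * hpar 2 k
  have hf0 (i : Fin 3) : aeval (fun l => aeval y (g l)) (f i) = 0 := by
    refine (mul_eq_zero.1 (?_ : N 0 k * _ = 0)).resolve_left hk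
    rw [hfc, map_mul, aeval_minors, cross_apply]
    fin_cases i <;> simp only [Fin.zero_eta, Fin.mk_one, Fin.reduceFinMk, cons_val]
    · linear_combination aeval (fun l => aeval y (g l)) (C c : PlaneRing K) *
        (aeval (fun l => aeval y (g l)) (φ 1 0) * hpl 2 -
          aeval (fun l => aeval y (g l)) (φ 2 0) * hpl 1)
    · linear_combination aeval (fun l => aeval y (g l)) (C c : PlaneRing K) *
        (aeval (fun l => aeval y (g l)) (φ 2 0) * hpl 0 -
          aeval (fun l => aeval y (g l)) (φ 0 0) * hpl 2)
    · linear_combination aeval (fun l => aeval y (g l)) (C c : PlaneRing K) *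
        (aeval (fun l => aeval y (g l)) (φ 0 0) * hpl 1 -
          aeval (fun l => aeval y (g l)) (φ 1 0) * hpl 0)
  have h1 := hf0 0
  rw [← hγ, hfg 0] at h1
  exact mul_ne_zero hD' (X_ne_zero 0)
    ((injective_iff_map_eq_zero (aeval (R := K) y)).1 hy _ h1)

/-- The second equation of the graph, restricted to the parametrized line `s ↦ a + s b`, with a
generic point `y` of the target. -/
noncomputable def lineEquation (φ : Matrix (Fin 3) (Fin 2) (PlaneRing K)) (y a b : Fin 3 → Ω) :
    Polynomial Ω :=
  ∑ i, Polynomial.C (y i) *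
    aeval (fun j => Polynomial.C (a j) + Polynomial.C (b j) * Polynomial.X) (φ i 1)

theorem eval_aeval_line (a b : Fin 3 → Ω) (s : Ω) (q : PlaneRing K) :
    (aeval (fun j => Polynomial.C (a j) + Polynomial.C (b j) * Polynomial.X) q).eval s =
      aeval (fun j => a j + b j * s) q := by
  have := congrFun (congrArg DFunLike.coe (comp_aeval (R := K)
    (fun j => Polynomial.C (a j) + Polynomial.C (b j) * Polynomial.X)
    ((Polynomial.aeval (R := Ω) s).restrictScalars K))) q
  simpa [Polynomial.coe_aeval_eq_eval] using this

theorem eval_lineEquation (y a b : Fin 3 → Ω) (s : Ω) :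
    (lineEquation φ y a b).eval s = ∑ i, y i * aeval (fun j => a j + b j * s) (φ i 1) := by
  simp [lineEquation, Polynomial.eval_finsetSum, eval_aeval_line]

theorem eval_derivative_lineEquation (y a b : Fin 3 → Ω) (s : Ω) :
    (Polynomial.derivative (lineEquation φ y a b)).eval s =
      ∑ j, (∑ i, y i * aeval (fun j => a j + b j * s) (pderiv j (φ i 1))) * b j := by
  have hder (q : PlaneRing K) :
      Polynomial.derivative (aeval (fun j => Polynomial.C (a j) + Polynomial.C (b j) *
        Polynomial.X) q) = ∑ j, aeval (fun j => Polynomial.C (a j) + Polynomial.C (b j) *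
        Polynomial.X) (pderiv j q) * Polynomial.C (b j) := by
    have := derivation_aeval ((Polynomial.derivative' (R := Ω)).restrictScalars K)
      (fun j => Polynomial.C (a j) + Polynomial.C (b j) * Polynomial.X) q
    simpa using this
  simp only [lineEquation, Polynomial.derivative_sum, Polynomial.derivative_C_mul, hder,
    Polynomial.eval_finsetSum, Polynomial.eval_mul, Polynomial.eval_C, eval_aeval_line,
    Finset.mul_sum, Finset.sum_mul]
  rw [Finset.sum_comm]
  simp only [mul_assoc]

/-- Both vectors are multiples of the nonzero vector `u × v`. -/
theorem parallel_of_orthogonal {z w u v : Fin 3 → Ω} (huv : u ⨯₃ v ≠ 0)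
    (hzu : ∑ i, u i * z i = 0) (hzv : ∑ i, v i * z i = 0)
    (hwu : ∑ i, u i * w i = 0) (hwv : ∑ i, v i * w i = 0) (i j : Fin 3) :
    z i * w j = z j * w i := by
  obtain ⟨k, hk⟩ := Function.ne_iff.1 huv
  rw [Pi.zero_apply] at hk
  have hz := mul_crossProduct_comm hzu hzv
  have hw := mul_crossProduct_comm hwu hwv
  refine mul_right_cancel₀ (mul_ne_zero hk hk) ?_
  linear_combination (u ⨯₃ v) k * w j * hz i k + z k * (u ⨯₃ v) i * hw j k -
    (u ⨯₃ v) k * w i * hz j k - z k * (u ⨯₃ v) j * hw i k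

/-- For a birational map, the equation of the graph on a line that passes through no base point
outside infinity has degree at most one. -/
theorem IsHilbertBurch.natDegree_lineEquation_le_one [IsAlgClosed Ω]
    (h : IsHilbertBurch f d μ₁ μ₂ φ)
    (hy : AlgebraicIndependent K y) {c : K} (hfc : ∀ i, f i = C c * minors φ i)
    (hg : ∀ j, (g j).IsHomogeneous e)
    {D : PlaneRing K} (hD : D ≠ 0) (hgf : ∀ j, aeval f (g j) = D * X j)
    {D' : MvPolynomial (Fin 3) K} (hD' : D' ≠ 0) (hfg : ∀ i, aeval g (f i) = D' * X i)
    {z : Fin 3 → Ω} (hz0 : z ≠ 0)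
    (hz : ∀ u : Fin 3 → Ω, ∀ j, ∑ i, y i * aeval u (pderiv j (φ i 0)) = z j)
    (hzl : ∀ u : Fin 3 → Ω, ∑ i, y i * aeval u (φ i 0) = ∑ j, u j * z j)
    {a b : Fin 3 → Ω} (hza : ∑ i, a i * z i = 0) (hzb : ∑ i, b i * z i = 0)
    (hab : a ⨯₃ b ≠ 0) (hbase : ∀ s, ∃ i, aeval (fun j => a j + b j * s) (f i) ≠ 0) :
    lineEquation φ y a b ≠ 0 ∧ (lineEquation φ y a b).natDegree ≤ 1 := by
  have hzx (s : Ω) : ∑ i, (a i + b i * s) * z i = 0 := by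
    simp only [Fin.sum_univ_three] at *
    linear_combination hza + s * hzb
  have hxb (s : Ω) : (fun i => a i + b i * s) ⨯₃ b = a ⨯₃ b := by
    simp only [cross_apply]
    congr! 1
    · ring
    congr! 1
    · ring
    congr! 1
    ring
  have hγ0 : ∃ k, aeval y (g k) ≠ 0 := by
    by_contra! h0
    have h1 : g 0 = 0 := (injective_iff_map_eq_zero (aeval (R := K) y)).1 hy _ (h0 0)
    have h2 := hgf 0
    rw [h1, map_zero] at h2
    exact mul_ne_zero hD (X_ne_zero 0) h2.symm
  have hroot {s : Ω} (hs : (lineEquation φ y a b).IsRoot s) (i j : Fin 3) :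
      (a i + b i * s) * aeval y (g j) = (a j + b j * s) * aeval y (g i) := by
    rw [Polynomial.IsRoot.def, eval_lineEquation] at hs
    exact mul_aeval_inverse_comm hy hfc hg hgf (x := fun i => a i + b i * s)
      (by rw [hzl]; exact hzx s) hs (hbase s) i j
  have huniq (s t : Ω) (hs : (lineEquation φ y a b).IsRoot s)
      (ht : (lineEquation φ y a b).IsRoot t) : s = t := by
    obtain ⟨k, hk⟩ := hγ0
    -- The points at `s` and `t` are both parallel to the nonzero vector `g(y)`, hence to each
    -- other; the left side is a coordinate of their cross product, up to sign.
    have hpar (i j : Fin 3) : (s - t) * (a i * b j - a j * b i) = 0 := by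
      refine mul_right_cancel₀ (mul_ne_zero hk hk) ?_
      linear_combination (a i + b i * t) * aeval y (g k) * hroot hs j k +
        (a k + b k * s) * aeval y (g j) * hroot ht i k -
        (a j + b j * t) * aeval y (g k) * hroot hs i k -
        (a k + b k * s) * aeval y (g i) * hroot ht j k
    by_contra hst
    apply hab
    have h2 (i j : Fin 3) := (mul_eq_zero.1 (hpar i j)).resolve_left (sub_ne_zero.2 hst)
    ext i
    rw [cross_apply]
    fin_cases i
    · exact h2 1 2
    · exact h2 2 0
    · exact h2 0 1
  refine ⟨fun h0 => zero_ne_one (huniq 0 1 (by simp [h0]) (by simp [h0])), ?_⟩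
  by_contra! hdeg
  obtain ⟨s, hs, hs'⟩ := exists_isRoot_derivative hdeg huniq
  set x : Fin 3 → Ω := fun i => a i + b i * s with hx
  have hxb0 : x ⨯₃ b ≠ 0 := by rw [hx, hxb]; exact hab
  obtain ⟨k, hk⟩ : ∃ k, x k ≠ 0 := by
    by_contra! h0
    exact hxb0 (by rw [show x = 0 from funext h0]; simp)
  obtain ⟨t, ht⟩ : ∃ t, ∀ j, aeval y (g j) = t * x j :=
    ⟨aeval y (g k) / x k, fun j => by
      have := hroot hs k j
      field_simp
      linear_combination this⟩
  set N : Fin 3 → Ω := fun j => ∑ i, y i * aeval x (pderiv j (φ i 1)) with hN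
  have hNb : ∑ j, b j * N j = 0 := by
    rw [Polynomial.IsRoot.def, eval_derivative_lineEquation] at hs'
    exact (Finset.sum_congr rfl fun j _ => mul_comm _ _).trans hs'
  -- Euler's identity: the sum is `μ₂` times the value of the second equation at `x`.
  have hNx : ∑ j, x j * N j = 0 := by
    rw [Polynomial.IsRoot.def, eval_lineEquation] at hs
    have h1 (i : Fin 3) := congrArg (aeval x) (h.homogeneous₂ i).sum_X_mul_pderiv
    simp only [map_sum, map_mul, aeval_X, map_nsmul] at h1
    simp only [hN, Finset.mul_sum]
    rw [Finset.sum_comm]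
    simp only [mul_left_comm (x _), ← Finset.mul_sum, h1, mul_smul_comm, ← Finset.smul_sum]
    rw [hs, smul_zero]
  have hpar := parallel_of_orthogonal hxb0 hNx hNb (hzx s) hzb
  -- Passing from `x` to `g(y) = t x` rescales the second differential by `t ^ (μ₂ - 1)`; the first
  -- is constant, as its equation is linear.
  refine hz0 (h.eq_zero_of_differentials_parallel hy hfc hD' hfg
    (N := ![z, fun j => t ^ (μ₂ - 1) * N j]) ?_ ?_)
  · intro k j
    fin_cases k
    · exact hz _ j
    · simp only [ht]
      simp only [Fin.mk_one, cons_val, hN, Finset.mul_sum]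
      refine Finset.sum_congr rfl fun i _ => ?_
      rw [aeval_mul_of_isHomogeneous (h.homogeneous₂ i).pderiv]
      ring
  · intro i j
    simp only [cons_val]
    linear_combination t ^ (μ₂ - 1) * hpar i j

end generic

/-! ### Linear changes of coordinates -/

section coordinates

variable {K : Type*} [Field K] {d μ₁ μ₂ : ℕ} {f : Fin 3 → PlaneRing K}
  {φ : Matrix (Fin 3) (Fin 2) (PlaneRing K)}

theorem substSource_X (A : GL (Fin 3) K) (i : Fin 3) :
    substSource A (X i) = ∑ j, C (A.val i j) * X j := by
  simp [substSource]

theorem substSource_C (A : GL (Fin 3) K) (r : K) : substSource A (C r) = C r :=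
  (substSource A).commutes r

theorem substSource_substSource (A B : GL (Fin 3) K) (q : PlaneRing K) :
    substSource A (substSource B q) = substSource (B * A) q := by
  have : (substSource A).comp (substSource B) = substSource (B * A) := by
    ext1 i
    simp only [AlgHom.comp_apply, substSource_X, map_sum, map_mul, substSource_C, Units.val_mul,
      Matrix.mul_apply, Finset.mul_sum, Finset.sum_mul]
    rw [Finset.sum_comm]
    simp only [mul_assoc]
  rw [← this, AlgHom.comp_apply]

theorem substSource_one (q : PlaneRing K) : substSource 1 q = q := by
  have : substSource (1 : GL (Fin 3) K) = AlgHom.id K _ := by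
    ext1 i
    simp [substSource_X, Matrix.one_apply]
  rw [this, AlgHom.id_apply]

@[simp]
theorem substSource_inv_substSource (A : GL (Fin 3) K) (q : PlaneRing K) :
    substSource A⁻¹ (substSource A q) = q := by
  rw [substSource_substSource, mul_inv_cancel, substSource_one]

@[simp]
theorem substSource_substSource_inv (A : GL (Fin 3) K) (q : PlaneRing K) :
    substSource A (substSource A⁻¹ q) = q := by
  rw [substSource_substSource, inv_mul_cancel, substSource_one]

theorem substSource_injective (A : GL (Fin 3) K) : Function.Injective (substSource A) :=
  Function.LeftInverse.injective (substSource_inv_substSource A)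

theorem isHomogeneous_substSource (A : GL (Fin 3) K) {q : PlaneRing K} {n : ℕ}
    (hq : q.IsHomogeneous n) : (substSource A q).IsHomogeneous n := by
  have := hq.aeval (fun i => ∑ j, C (A.val i j) * X j : Fin 3 → PlaneRing K)
    fun i => IsHomogeneous.sum _ _ 1 fun j _ => isHomogeneous_C_mul_X _ _
  rwa [one_mul] at this

/-- The forms defining the rational map after the substitution `A` in the source and the
substitution `B` in the target. -/
noncomputable def changeForms (A B : GL (Fin 3) K) (f : Fin 3 → PlaneRing K) :
    Fin 3 → PlaneRing K :=
  fun j => substSource A (aeval f (substSource B (X j)))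

theorem aeval_changeForms (A B : GL (Fin 3) K) (q : PlaneRing K) :
    aeval (changeForms A B f) q = substSource A (aeval f (substSource B q)) := by
  have : aeval (changeForms A B f) =
      (substSource A).comp ((aeval f).comp (substSource B)) := by
    ext1 i
    simp [changeForms]
  rw [this]
  rfl

theorem changeForms_inv (A B : GL (Fin 3) K) :
    changeForms A⁻¹ B⁻¹ (changeForms A B f) = f := by
  ext1 j
  rw [changeForms, aeval_changeForms]
  simp

theorem IsDominant.comp_linear (h : IsDominant f) (A B : GL (Fin 3) K) :
    IsDominant (changeForms A B f) := by
  intro p q hpq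
  rw [aeval_changeForms, aeval_changeForms] at hpq
  exact substSource_injective B (h (substSource_injective A hpq))

theorem isHomogeneous_changeForms (hf : ∀ i, (f i).IsHomogeneous d) (A B : GL (Fin 3) K)
    (i : Fin 3) : (changeForms A B f i).IsHomogeneous d := by
  have := (isHomogeneous_substSource B (isHomogeneous_X K i)).aeval f hf
  rw [mul_one] at this
  exact isHomogeneous_substSource A this

/-- Only the left inverse has to be transformed; `IsDominant.isBirational` supplies the other
composite. -/
theorem IsBirational.comp_linear (h : IsBirational f) (hf : ∀ i, (f i).IsHomogeneous d)
    (A B : GL (Fin 3) K) : IsBirational (changeForms A B f) := by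
  obtain ⟨hdom, e, g, hg, ⟨D, hD, hgf⟩, -⟩ := h
  refine (hdom.comp_linear A B).isBirational (isHomogeneous_changeForms hf A B) (e := e)
    (g := fun i => ∑ j, C ((A⁻¹).val i j) * substSource B⁻¹ (g j)) (D := substSource A D)
    (fun j => IsHomogeneous.sum _ _ _ fun k _ => (isHomogeneous_substSource _ (hg k)).C_mul _)
    (fun h0 => hD (substSource_injective A (by rw [h0, map_zero]))) fun i => ?_
  have h1 : substSource A (substSource A⁻¹ (X i)) = (X i : PlaneRing K) := by simp
  simp only [substSource_X A⁻¹, map_sum, map_mul, substSource_C] at h1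
  simp only [map_sum, map_mul, aeval_changeForms, substSource_substSource_inv, substSource_C, hgf]
  rw [← h1, Finset.mul_sum]
  refine Finset.sum_congr rfl fun j _ => ?_
  simp [mul_left_comm]

/-- The transposed inverse matrix. -/
noncomputable def dual (P : GL (Fin 3) K) : GL (Fin 3) K where
  val := (P⁻¹).valᵀ
  inv := P.valᵀ
  val_inv := by rw [← Matrix.transpose_mul, ← Units.val_mul]; simp
  inv_val := by rw [← Matrix.transpose_mul, ← Units.val_mul]; simp

/-- An invertible matrix over the field as a matrix of polynomials. -/
noncomputable def constMatrix (P : GL (Fin 3) K) : Matrix (Fin 3) (Fin 3) (PlaneRing K) :=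
  P.val.map (C : K →+* PlaneRing K)

theorem constMatrix_mul_constMatrix {P Q : GL (Fin 3) K} (h : P * Q = 1) :
    constMatrix P * constMatrix Q = 1 := by
  rw [constMatrix, constMatrix, ← Matrix.map_mul, ← Units.val_mul, h, Units.val_one,
    Matrix.map_one _ (map_zero _) (map_one _)]

/-- The matrix `φ` after the substitution `A` in the source. -/
noncomputable def substMatrix (A : GL (Fin 3) K) (φ : Matrix (Fin 3) (Fin 2) (PlaneRing K)) :
    Matrix (Fin 3) (Fin 2) (PlaneRing K) :=
  φ.map (substSource A).toRingHom

theorem changeCoords_eq (A P : GL (Fin 3) K) :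
    changeCoords A P φ = constMatrix P * substMatrix A φ := by
  ext1 i k
  rw [Matrix.mul_apply]
  rfl

theorem changeCoords_inv (A P : GL (Fin 3) K) :
    changeCoords A⁻¹ P⁻¹ (changeCoords A P φ) = φ := by
  have h1 : (constMatrix P).map (substSource A⁻¹).toRingHom = constMatrix P := by
    ext1 i j
    exact substSource_C _ _
  have h2 : (substMatrix A φ).map (substSource A⁻¹).toRingHom = φ := by
    ext1 i j
    exact substSource_inv_substSource _ _
  rw [changeCoords_eq, changeCoords_eq, substMatrix, Matrix.map_mul, h1, h2, ← Matrix.mul_assoc,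
    constMatrix_mul_constMatrix (inv_mul_cancel P), Matrix.one_mul]

/-- As a row, the new forms are `f(Ax) P⁻¹`, whose factor `P⁻¹` cancels against `P` in the matrix;
this is why the target substitution is `dual P`. -/
theorem IsHilbertBurch.comp_linear (h : IsHilbertBurch f d μ₁ μ₂ φ) (A P : GL (Fin 3) K) :
    IsHilbertBurch (changeForms A (dual P) f) d μ₁ μ₂ (changeCoords A P φ) := by
  have hσ (v : Fin 3 → PlaneRing K) (u : Fin 2 → PlaneRing K) :
      substMatrix A φ *ᵥ (substSource A ∘ u) = v ↔ φ *ᵥ u = substSource A⁻¹ ∘ v := by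
    have h1 : substMatrix A φ *ᵥ (substSource A ∘ u) = substSource A ∘ (φ *ᵥ u) := by
      ext1 i
      exact (RingHom.map_mulVec (substSource A).toRingHom φ u i).symm
    rw [h1]
    constructor
    · rintro rfl
      ext1 i
      simp
    · intro h2
      rw [h2]
      ext1 i
      simp
  have hP (v w : Fin 3 → PlaneRing K) :
      constMatrix P *ᵥ v = w ↔ v = constMatrix P⁻¹ *ᵥ w := by
    constructor
    · rintro rfl
      rw [mulVec_mulVec, constMatrix_mul_constMatrix (inv_mul_cancel P), one_mulVec]
    · rintro rfl
      rw [mulVec_mulVec, constMatrix_mul_constMatrix (mul_inv_cancel P), one_mulVec]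
  have hu (u : Fin 2 → PlaneRing K) : u = substSource A ∘ (substSource A⁻¹ ∘ u) := by
    ext1 i
    simp
  have hkey (u : Fin 2 → PlaneRing K) (v : Fin 3 → PlaneRing K) :
      changeCoords A P φ *ᵥ u = v ↔
        φ *ᵥ (substSource A⁻¹ ∘ u) = substSource A⁻¹ ∘ (constMatrix P⁻¹ *ᵥ v) := by
    rw [← hσ, ← hP, ← hu, changeCoords_eq, mulVec_mulVec]
  refine ⟨h.sum_eq, h.le, fun i => ?_, fun i => ?_, fun u u' huu => ?_, fun v => ?_⟩
  · exact IsHomogeneous.sum Finset.univ _ _ fun j _ =>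
      (isHomogeneous_substSource A (h.homogeneous₁ j)).C_mul (P.val i j)
  · exact IsHomogeneous.sum Finset.univ _ _ fun j _ =>
      (isHomogeneous_substSource A (h.homogeneous₂ j)).C_mul (P.val i j)
  · have h1 := (hkey u _).1 rfl
    have h2 := (hkey u' _).1 rfl
    have h3 := h.injective (h1.trans ((congrArg (fun v => substSource A⁻¹ ∘
      (constMatrix P⁻¹ *ᵥ v)) huu).trans h2.symm))
    rw [hu u, h3, ← hu]
  · have h1 : ∑ i, changeForms A (dual P) f i * v i = substSource A (∑ i, f i *
        (substSource A⁻¹ ∘ (constMatrix P⁻¹ *ᵥ v)) i) := by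
      simp only [changeForms, substSource_X, map_sum, map_mul, Function.comp_apply,
        substSource_substSource_inv, aeval_X, algHom_C, dual, transpose_apply, mulVec, dotProduct,
        constMatrix, Matrix.map_apply, Finset.mul_sum, Finset.sum_mul, algebraMap_eq]
      rw [Finset.sum_comm]
      refine Finset.sum_congr rfl fun i _ => Finset.sum_congr rfl fun j _ => ?_
      ring
    rw [h1, map_eq_zero_iff _ (substSource_injective A), h.exact]
    constructor
    · rintro ⟨u, hu'⟩
      refine ⟨substSource A ∘ u, (hkey _ _).2 ?_⟩
      rw [← hu']
      congr 1
      ext1 i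
      simp
    · rintro ⟨u, hu'⟩
      exact ⟨_, (hkey _ _).1 hu'⟩

theorem height_entryIdeal_le (A P : GL (Fin 3) K) :
    (entryIdeal (changeCoords A P φ)).height ≤ (entryIdeal φ).height := by
  let e : PlaneRing K ≃+* PlaneRing K :=
    { (substSource A).toRingHom with
      invFun := substSource A⁻¹
      left_inv := substSource_inv_substSource A
      right_inv := substSource_substSource_inv A }
  rw [← RingEquiv.height_map e (entryIdeal φ)]
  refine Ideal.height_mono (Ideal.span_le.2 ?_)
  rintro _ ⟨⟨i, k⟩, rfl⟩
  exact Ideal.sum_mem (t := Finset.univ) _ fun j _ => Ideal.mul_mem_left _ (C (P.val i j))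
    (Ideal.mem_map_of_mem e (show φ j k ∈ entryIdeal φ from Ideal.subset_span ⟨(j, k), rfl⟩))

theorem height_entryIdeal_changeCoords (A P : GL (Fin 3) K) :
    (entryIdeal (changeCoords A P φ)).height = (entryIdeal φ).height := by
  refine le_antisymm (height_entryIdeal_le A P) ?_
  have := height_entryIdeal_le (φ := changeCoords A P φ) A⁻¹ P⁻¹
  rwa [changeCoords_inv] at this

theorem changeCoords_col_zero {B : Matrix (Fin 3) (Fin 3) K}
    (hB : ∀ i, φ i 0 = ∑ j, C (B i j) * X j) (A P : GL (Fin 3) K) (i : Fin 3) :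
    changeCoords A P φ i 0 = ∑ j, C ((P.val * B * A.val) i j) * X j := by
  simp only [changeCoords, of_apply, hB, map_sum, map_mul, substSource_C, substSource_X,
    Matrix.mul_apply, Finset.mul_sum, Finset.sum_mul]
  simp only [Fin.sum_univ_three]
  ring

theorem exists_matrix_of_isHomogeneous_one {l : Fin 3 → PlaneRing K}
    (hl : ∀ i, (l i).IsHomogeneous 1) :
    ∃ B : Matrix (Fin 3) (Fin 3) K, ∀ i, l i = ∑ j, C (B i j) * X j := by
  have (i : Fin 3) : ∃ b : Fin 3 → K, ∑ j, b j • X j = l i := by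
    rw [← Submodule.mem_span_range_iff_exists_fun, ← homogeneousSubmodule_one_eq_span_X]
    exact hl i
  choose B hB using this
  exact ⟨B, fun i => by rw [← hB]; simp [smul_eq_C_mul]⟩

/-- Suitable linear coordinates bring a column of three linear forms to the form `(x₀, x₁, x₂)` or
`(x₀, -x₁, 0)`. -/
theorem IsHilbertBurch.exists_changeCoords (h : IsHilbertBurch f d 1 μ₂ φ) (hdom : IsDominant f) :
    ∃ A P : GL (Fin 3) K, (∀ i, changeCoords A P φ i 0 = X i) ∨
      IsNormalForm (changeCoords A P φ) := by
  obtain ⟨B, hB⟩ := exists_matrix_of_isHomogeneous_one h.homogeneous₁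
  obtain ⟨L, L', D, hD⟩ := Matrix.Pivot.exists_list_transvec_mul_mul_list_transvec_eq_diagonal B
  set U := (L.map TransvectionStruct.toMatrix).prod
  set V := (L'.map TransvectionStruct.toMatrix).prod
  have hU : U.det = 1 := TransvectionStruct.det_toMatrix_prod L
  have hV : V.det = 1 := TransvectionStruct.det_toMatrix_prod L'
  -- the diagonal has no two zeros
  have hD2 {j k : Fin 3} (hjk : j ≠ k) (hj : D j = 0) : D k ≠ 0 := by
    intro hk
    set A := Matrix.GeneralLinearGroup.mkOfDetNeZero V (by simp [hV])
    set P := Matrix.GeneralLinearGroup.mkOfDetNeZero U (by simp [hU])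
    have hcol (i : Fin 3) : changeCoords A P φ i 0 = C (D i) * X i := by
      rw [changeCoords_col_zero hB]
      change ∑ j, C ((U * B * V) i j) * X j = _
      rw [hD]
      simp [diagonal_apply, apply_ite (C : K → PlaneRing K)]
    have h' := h.comp_linear A P
    have hdom' := hdom.comp_linear A (dual P)
    have hsum := h'.sum_mul_col 0
    obtain ⟨i, hij, hik⟩ : ∃ i : Fin 3, i ≠ j ∧ i ≠ k := by clear hj hk; revert j k; decide
    have hrest (l : Fin 3) (hl : l ≠ i) : D l = 0 := by
      have : l = j ∨ l = k := by clear hj hk; revert i j k l; decide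
      rcases this with rfl | rfl <;> assumption
    -- Only one term `f_i * D_i * x_i` of the syzygy is left. It forces the whole column to vanish,
    -- against injectivity.
    rw [Finset.sum_eq_single i (fun l _ hl => by simp [hcol, hrest l hl]) (by simp), hcol,
      mul_eq_zero] at hsum
    have hi : D i = 0 := by
      have := (mul_eq_zero.1 (hsum.resolve_left (hdom'.ne_zero i))).resolve_right (X_ne_zero i)
      simpa using this
    have hall (l : Fin 3) : D l = 0 := by
      by_cases hl : l = i
      · rw [hl, hi]
      · exact hrest l hl
    have := h'.injective (a₁ := ![1, 0]) (a₂ := 0) (by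
      ext1 l
      simp [mulVec, dotProduct, Fin.sum_univ_two, hcol, hall])
    simpa using congrFun this 0
  obtain ⟨π, hπ⟩ : ∃ π : Equiv.Perm (Fin 3), D (π 0) ≠ 0 ∧ D (π 1) ≠ 0 := by
    by_cases h2 : D 2 = 0
    · exact ⟨1, hD2 (by decide) h2, hD2 (by decide) h2⟩
    by_cases h1 : D 1 = 0
    · exact ⟨Equiv.swap 1 2, hD2 (by decide) h1, by simpa using h2⟩
    · exact ⟨Equiv.swap 0 2, by simpa using h2, by
        rwa [Equiv.swap_apply_of_ne_of_ne (by decide) (by decide)]⟩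
  -- The permutation `π` puts nonzero diagonal entries in places `0` and `1`; rescaling rows then
  -- normalizes all nonzero entries.
  have hscale (c : Fin 3 → K) (hc : ∀ i, c i ≠ 0) : ∃ A P : GL (Fin 3) K,
      ∀ i, changeCoords A P φ i 0 = C (c i * D (π i)) * X i := by
    have hdet : (diagonal c * U.submatrix π id).det ≠ 0 := by
      rw [det_mul, det_diagonal, det_permute, hU, mul_one]
      refine mul_ne_zero (Finset.prod_ne_zero_iff.2 fun i _ => hc i) ?_
      exact_mod_cast ((Equiv.Perm.sign π).map (Int.castRingHom K).toMonoidHom).ne_zero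
    have hdet' : (V.submatrix id π).det ≠ 0 := by
      rw [det_permute', hV, mul_one]
      exact_mod_cast ((Equiv.Perm.sign π).map (Int.castRingHom K).toMonoidHom).ne_zero
    refine ⟨Matrix.GeneralLinearGroup.mkOfDetNeZero _ hdet',
      Matrix.GeneralLinearGroup.mkOfDetNeZero _ hdet, fun i => ?_⟩
    rw [changeCoords_col_zero hB]
    change ∑ j, C ((diagonal c * U.submatrix π id * B * V.submatrix id π) i j) * X j = _
    have : diagonal c * U.submatrix π id * B * V.submatrix id π =
        diagonal fun i => c i * D (π i) := by
      have h1 : U.submatrix π id * B * V.submatrix id π = diagonal fun i => D (π i) := by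
        have h2 : U.submatrix π id * B * V.submatrix id π = (U * B * V).submatrix π π := by
          ext i j
          simp [Matrix.mul_apply]
        rw [h2, hD]
        ext i j
        simp [diagonal_apply]
      rw [Matrix.mul_assoc, Matrix.mul_assoc, ← Matrix.mul_assoc (U.submatrix π id), h1,
        diagonal_mul_diagonal]
    rw [this]
    simp [diagonal_apply, apply_ite (C : K → PlaneRing K)]
  by_cases h2 : D (π 2) = 0
  · obtain ⟨A, P, hAP⟩ := hscale ![(D (π 0))⁻¹, -(D (π 1))⁻¹, 1] (fun i => by
      fin_cases i <;> simp [hπ.1, hπ.2])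
    exact ⟨A, P, Or.inr ⟨by simp [hAP, hπ.1], by simp [hAP, hπ.2], by simp [hAP, h2]⟩⟩
  · obtain ⟨A, P, hAP⟩ := hscale (fun i => (D (π i))⁻¹) (fun i => by
      fin_cases i <;> simp [hπ.1, hπ.2, h2])
    refine ⟨A, P, Or.inl fun i => ?_⟩
    rw [hAP]
    fin_cases i <;> simp [hπ.1, hπ.2, h2]

end coordinates

/-! ### Birationality as a degree condition -/

theorem exists_generic_point.{u} (K : Type u) [Field K] :
    ∃ (Ω : Type u) (_ : Field Ω) (_ : Algebra K Ω) (_ : IsAlgClosed Ω) (y : Fin 3 → Ω),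
      AlgebraicIndependent K y := by
  refine ⟨AlgebraicClosure (FractionRing (MvPolynomial (Fin 3) K)), inferInstance, inferInstance,
    inferInstance, fun i => algebraMap (MvPolynomial (Fin 3) K) _ (X i), ?_⟩
  have h : aeval (R := K) (fun i => algebraMap (MvPolynomial (Fin 3) K)
      (AlgebraicClosure (FractionRing (MvPolynomial (Fin 3) K))) (X i)) =
      IsScalarTower.toAlgHom K _ _ := by
    ext1 i
    simp
  rw [AlgebraicIndependent, h]
  rw [IsScalarTower.coe_toAlgHom', IsScalarTower.algebraMap_eq (MvPolynomial (Fin 3) K)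
    (FractionRing (MvPolynomial (Fin 3) K)), RingHom.coe_comp]
  exact (algebraMap (FractionRing (MvPolynomial (Fin 3) K)) _).injective.comp
    (IsFractionRing.injective (MvPolynomial (Fin 3) K) (FractionRing (MvPolynomial (Fin 3) K)))

section

variable {K : Type*} [Field K] {d μ₂ : ℕ} {f : Fin 3 → PlaneRing K}
  {φ : Matrix (Fin 3) (Fin 2) (PlaneRing K)}

theorem not_X_zero_dvd {q : PlaneRing K} (hq : q = X 1 ∨ q = -X 1) :
    ¬ (X 0 : PlaneRing K) ∣ q := by
  rcases hq with rfl | rfl <;> simp [X_dvd_X]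

/-- If two entries of the first column are independent variables, the forms are a constant multiple
of the maximal minors and have no common divisor. -/
theorem IsHilbertBurch.exists_eq_C_mul_minors_and_isUnit (h : IsHilbertBurch f d 1 μ₂ φ)
    (hf : ∀ i, (f i).IsHomogeneous d) (hdom : IsDominant f)
    (h0 : φ 0 0 = X 0) (h1 : φ 1 0 = X 1 ∨ φ 1 0 = -X 1) :
    ∃ c : K, (∀ i, f i = C c * minors φ i) ∧ ∀ e, (∀ i, e ∣ f i) → IsUnit e := by
  have hp : Prime (φ 0 0) := by rw [h0]; exact X_prime
  have hnd : ¬ φ 0 0 ∣ φ 1 0 := by rw [h0]; exact not_X_zero_dvd h1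
  obtain ⟨c, hc, hfc⟩ := h.exists_eq_C_mul_minors hf
    (fun hf0 => hdom.ne_zero 0 (congrFun hf0 0)) hp hnd
  refine ⟨c, hfc, fun e he => h.isUnit_of_dvd_minors (fun e he => ?_) fun i => ?_⟩
  · rcases hp.irreducible.dvd_iff.1 (he 0) with hu | ha
    · exact hu
    · exact absurd (ha.dvd.trans (he 1)) hnd
  · have := he i
    rwa [hfc, (((isUnit_iff_ne_zero.2 hc).map C)).dvd_mul_left] at this

/-- A base point has algebraic coordinate ratios, and independent elements satisfy no linear
relation with such coefficients. -/
theorem aeval_ne_zero_of_sum_eq_zero {Ω : Type*} [Field Ω] [Algebra K Ω] {y : Fin 3 → Ω}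
    (hy : AlgebraicIndependent K y) (hf : ∀ i, (f i).IsHomogeneous d)
    (hprim : ∀ e, (∀ i, e ∣ f i) → IsUnit e) {x : Fin 3 → Ω} {k : Fin 3} (hk : x k ≠ 0)
    (hx : ∑ i, x i * y i = 0) : ∃ i, aeval x (f i) ≠ 0 := by
  by_contra! h0
  have h1 := eq_zero_of_sum_mul_eq_zero hy
    (fun j => isAlgebraic_div_of_aeval_eq_zero hf hprim h0 j k hk)
    (by simp only [div_mul_eq_mul_div, ← Finset.sum_div, hx, zero_div]) k
  rw [div_self hk] at h1
  exact one_ne_zero h1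

theorem degree_eq_of_mem_support {p : PlaneRing K} {n : ℕ} (hp : p.IsHomogeneous n)
    {m : Fin 3 →₀ ℕ} (hm : m ∈ p.support) : m 0 + m 1 + m 2 = n := by
  rw [← hp (mem_support_iff.1 hm), Finsupp.weight_apply, Finsupp.sum_fintype _ _ (by simp)]
  simp [Fin.sum_univ_three]

/-- The top coefficient is the value at `b`, the point at infinity of the parametrized line. -/
theorem coeff_aeval_line {Ω : Type*} [Field Ω] [Algebra K Ω] {p : PlaneRing K} {n : ℕ}
    (hp : p.IsHomogeneous n) (a b : Fin 3 → Ω) :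
    (aeval (fun j => Polynomial.C (a j) + Polynomial.C (b j) * Polynomial.X) p).coeff n =
      aeval b p := by
  rw [aeval_def, aeval_def, eval₂_eq', eval₂_eq', Polynomial.finsetSum_coeff]
  refine Finset.sum_congr rfl fun m hm => ?_
  have hn := degree_eq_of_mem_support hp hm
  have hdeg (j : Fin 3) :
      (Polynomial.C (a j) + Polynomial.C (b j) * Polynomial.X).natDegree ≤ 1 := by
    rw [add_comm]; exact Polynomial.natDegree_linear_le
  have hpow (j : Fin 3) (k : ℕ) :
      ((Polynomial.C (a j) + Polynomial.C (b j) * Polynomial.X) ^ k).natDegree ≤ k :=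
    (Polynomial.natDegree_pow_le_of_le k (hdeg j)).trans (by simp)
  have hcoeff (j : Fin 3) (k : ℕ) :
      ((Polynomial.C (a j) + Polynomial.C (b j) * Polynomial.X) ^ k).coeff k = b j ^ k := by
    have := Polynomial.coeff_pow_of_natDegree_le (m := k) (hdeg j)
    rw [mul_one] at this
    rw [this]; simp
  rw [IsScalarTower.algebraMap_apply K Ω (Polynomial Ω), Polynomial.algebraMap_eq,
    Polynomial.coeff_C_mul, Fin.prod_univ_three, Fin.prod_univ_three, ← hn,
    Polynomial.coeff_mul_add_eq_of_natDegree_le (Polynomial.natDegree_mul_le_of_le (hpow 0 _) (hpow 1 _))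
      (hpow 2 _), Polynomial.coeff_mul_add_eq_of_natDegree_le (hpow 0 _) (hpow 1 _), hcoeff, hcoeff,
    hcoeff]

theorem aeval_inverse_ne_zero {Ω : Type*} [Field Ω] [Algebra K Ω] {y : Fin 3 → Ω}
    (hy : AlgebraicIndependent K y) {g : Fin 3 → MvPolynomial (Fin 3) K}
    {D : PlaneRing K} (hD : D ≠ 0) (hgf : ∀ j, aeval f (g j) = D * X j) (k : Fin 3) :
    aeval y (g k) ≠ 0 := by
  intro h0
  have h1 : g k = 0 := (injective_iff_map_eq_zero (aeval (R := K) y)).1 hy _ h0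
  have h2 := hgf k
  rw [h1, map_zero] at h2
  exact mul_ne_zero hD (X_ne_zero k) h2.symm

/-- A map with the linear syzygy `(x₀, x₁, x₂)` is birational only in degree two. -/
theorem IsHilbertBurch.not_isBirational (h : IsHilbertBurch f d 1 μ₂ φ) (hd : 3 ≤ d)
    (hf : ∀ i, (f i).IsHomogeneous d) (hcol : ∀ i, φ i 0 = X i) : ¬ IsBirational f := by
  rintro ⟨hdom, e, g, hg, ⟨D, hD, hgf⟩, D', hD', hfg⟩
  obtain ⟨c, hfc, hprim⟩ := h.exists_eq_C_mul_minors_and_isUnit hf hdom (hcol 0) (Or.inl (hcol 1))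
  obtain ⟨Ω, _, _, _, y, hy⟩ := exists_generic_point K
  have hy0 (i : Fin 3) : y i ≠ 0 := hy.ne_zero i
  obtain ⟨-, hdeg⟩ := h.natDegree_lineEquation_le_one hy hfc hg hD hgf hD' hfg (z := y)
    (a := ![0, y 2, -y 1]) (b := ![y 2, 0, -y 0])
    (fun hz => hy0 0 (congrFun hz 0))
    (fun u j => by simp [hcol, pderiv_X, Pi.single_apply, apply_ite (aeval u)])
    (fun u => by simp [hcol, mul_comm])
    (by simp [Fin.sum_univ_three]; ring) (by simp [Fin.sum_univ_three]; ring)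
    (fun h0 => mul_ne_zero (hy0 2) (hy0 2) (by simpa [cross_apply] using congrFun h0 2))
    (fun s => aeval_ne_zero_of_sum_eq_zero hy hf hprim (k := 1) (by simp [hy0 2])
      (by simp [Fin.sum_univ_three]; ring))
  have hμ := h.sum_eq
  -- Since `μ₂ ≥ 2` exceeds the degree, the point at infinity lies in the fibre and must be `g(y)`;
  -- but its middle coordinate is zero.
  have h1 : ∑ i, y i * aeval ![y 2, 0, -y 0] (φ i 1) = 0 := by
    have h2 := Polynomial.coeff_eq_zero_of_natDegree_lt (n := μ₂) (hdeg.trans_lt (by omega))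
    simpa only [lineEquation, Polynomial.finsetSum_coeff, Polynomial.coeff_C_mul,
      coeff_aeval_line (h.homogeneous₂ _)] using h2
  have hyb : ∑ i, (![y 2, 0, -y 0] : Fin 3 → Ω) i * y i = 0 := by
    simp [Fin.sum_univ_three]; ring
  have h3 := mul_aeval_inverse_comm hy hfc hg hgf (x := ![y 2, 0, -y 0])
    (by simpa only [hcol, aeval_X, mul_comm] using hyb) h1
    (aeval_ne_zero_of_sum_eq_zero hy hf hprim (k := 0) (by simp [hy0 2]) hyb) 0 1
  simp [hy0 2] at h3
  exact aeval_inverse_ne_zero hy hD hgf 1 h3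

/-- The second equation of the graph on the line `y₀ x₀ = y₁ x₁`, parametrized by
`s ↦ (y₁, y₀, s)`. -/
noncomputable def fiberPolynomial (φ : Matrix (Fin 3) (Fin 2) (PlaneRing K)) :
    Polynomial (MvPolynomial (Fin 3) K) :=
  ∑ i, Polynomial.C (X i) *
    aeval ![Polynomial.C (X 1), Polynomial.C (X 0), Polynomial.X] (φ i 1)

theorem map_fiberPolynomial {Ω : Type*} [Field Ω] [Algebra K Ω] (y : Fin 3 → Ω) :
    (fiberPolynomial φ).map (aeval (R := K) y).toRingHom =
      lineEquation φ y ![y 1, y 0, 0] ![0, 0, 1] := by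
  have h (q : PlaneRing K) : (aeval ![Polynomial.C (X 1 : MvPolynomial (Fin 3) K),
      Polynomial.C (X 0), Polynomial.X] q).map (aeval (R := K) y).toRingHom =
      aeval (fun j => Polynomial.C ((![y 1, y 0, 0] : Fin 3 → Ω) j) +
        Polynomial.C ((![0, 0, 1] : Fin 3 → Ω) j) * Polynomial.X) q := by
    have : (Polynomial.mapAlgHom (aeval (R := K) y)).comp
        (aeval ![Polynomial.C (X 1 : MvPolynomial (Fin 3) K), Polynomial.C (X 0), Polynomial.X]) =
      aeval (fun j => Polynomial.C ((![y 1, y 0, 0] : Fin 3 → Ω) j) +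
        Polynomial.C ((![0, 0, 1] : Fin 3 → Ω) j) * Polynomial.X) := by
      ext1 j
      fin_cases j <;> simp
    exact congrFun (congrArg DFunLike.coe this) q
  simp only [fiberPolynomial, Polynomial.map_sum, Polynomial.map_mul, Polynomial.map_C, h]
  simp [lineEquation]

theorem IsHilbertBurch.natDegree_fiberPolynomial (h : IsHilbertBurch f d 1 μ₂ φ)
    (hf : ∀ i, (f i).IsHomogeneous d) (hφ : IsNormalForm φ) (hbir : IsBirational f) :
    (fiberPolynomial φ).natDegree = 1 := by
  obtain ⟨hdom, e, g, hg, ⟨D, hD, hgf⟩, D', hD', hfg⟩ := hbir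
  obtain ⟨h0, h1, h2⟩ := hφ
  obtain ⟨c, hfc, hprim⟩ := h.exists_eq_C_mul_minors_and_isUnit hf hdom h0 (Or.inr h1)
  obtain ⟨Ω, _, _, _, y, hy⟩ := exists_generic_point K
  have hy0 (i : Fin 3) : y i ≠ 0 := hy.ne_zero i
  rw [← Polynomial.natDegree_map_eq_of_injective
    (f := (aeval (R := K) y).toRingHom) hy, map_fiberPolynomial]
  obtain ⟨hne, hdeg⟩ := h.natDegree_lineEquation_le_one hy hfc hg hD hgf hD' hfg
    (z := ![y 0, -y 1, 0]) (a := ![y 1, y 0, 0]) (b := ![0, 0, 1])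
    (fun hz => hy0 0 (by simpa using congrFun hz 0))
    (fun u j => by
      fin_cases j <;> simp [Fin.sum_univ_three, h0, h1, h2, pderiv_X])
    (fun u => by simp [Fin.sum_univ_three, h0, h1, h2]; ring)
    (by simp [Fin.sum_univ_three]; ring) (by simp [Fin.sum_univ_three])
    (fun h0 => hy0 0 (by simpa [cross_apply] using congrFun h0 0))
    (fun s => by
      by_contra! hb
      -- A base point `(y₁, y₀, s)` would make `y₀ / y₁` algebraic, contradicting independence
      -- through `-y₀ + (y₀ / y₁) y₁ = 0`.
      have halg := isAlgebraic_div_of_aeval_eq_zero hf hprim hb 1 0 (by simp [hy0 1])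
      have := eq_zero_of_sum_mul_eq_zero hy (u := ![-1, y 0 / y 1, 0]) (fun i => by
          fin_cases i
          · exact isAlgebraic_one.neg
          · simpa using halg
          · exact isAlgebraic_zero)
        (by simp [Fin.sum_univ_three, hy0 1]) 0
      simp at this)
  refine le_antisymm hdeg (Nat.one_le_iff_ne_zero.2 fun h00 => hne ?_)
  have hγ1 := aeval_inverse_ne_zero hy hD hgf 1
  have hγ (q : PlaneRing K) : aeval y (aeval g q) = aeval (fun l => aeval y (g l)) q := by
    rw [← AlgHom.comp_apply, comp_aeval]
  have e0 := congrArg (aeval y) (h.sum_X_mul_aeval hD' hfg 0)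
  have e1 := congrArg (aeval y) (h.sum_X_mul_aeval hD' hfg 1)
  simp only [map_sum, map_mul, hγ, aeval_X, map_zero] at e0 e1
  simp only [Fin.sum_univ_three, h0, h1, h2, aeval_X, map_neg, map_zero, mul_zero, add_zero] at e0
  -- The point `g(y)` lies on the line; scaled to have middle coordinate `y₀`, it provides a root,
  -- so the degree cannot be zero.
  have hroot : (lineEquation φ y ![y 1, y 0, 0] ![0, 0, 1]).eval
      (y 0 / aeval y (g 1) * aeval y (g 2)) = 0 := by
    rw [eval_lineEquation]
    have hx : (fun j => (![y 1, y 0, 0] : Fin 3 → Ω) j + (![0, 0, 1] : Fin 3 → Ω) j *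
        (y 0 / aeval y (g 1) * aeval y (g 2))) =
        fun j => y 0 / aeval y (g 1) * aeval y (g j) := by
      ext1 j
      fin_cases j
      · simp
        field_simp
        linear_combination -e0
      · simp [hγ1]
      · simp
    simp only [hx, aeval_mul_of_isHomogeneous (h.homogeneous₂ _), mul_left_comm (y _)]
    rw [← Finset.mul_sum, e1, mul_zero]
  rw [Polynomial.natDegree_eq_zero] at h00
  obtain ⟨r, hr⟩ := h00
  rw [← hr] at hroot ⊢
  rw [Polynomial.eval_C] at hroot
  rw [hroot, Polynomial.C_0]

theorem aeval_fiber_eq_sum {A : Type*} [CommSemiring A] [Algebra K A] (u v w : A) (p : PlaneRing K) :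
    aeval ![u, v, w] p =
      ∑ m ∈ p.support, algebraMap K A (coeff m p) * (u ^ m 0 * v ^ m 1 * w ^ m 2) := by
  rw [aeval_def, eval₂_eq']
  simp [Fin.prod_univ_three]

theorem coeff_aeval_fiber (p : PlaneRing K) (k : ℕ) :
    (aeval ![Polynomial.C (X 1 : MvPolynomial (Fin 3) K), Polynomial.C (X 0), Polynomial.X]
      p).coeff k =
      ∑ m ∈ p.support, if k = m 2 then C (coeff m p) * (X 1 ^ m 0 * X 0 ^ m 1) else 0 := by
  rw [aeval_fiber_eq_sum, Polynomial.finsetSum_coeff]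
  refine Finset.sum_congr rfl fun m _ => ?_
  rw [IsScalarTower.algebraMap_apply K (MvPolynomial (Fin 3) K) (Polynomial _),
    Polynomial.algebraMap_eq, algebraMap_eq, ← Polynomial.C_pow, ← Polynomial.C_pow,
    ← Polynomial.C_mul, ← mul_assoc, ← Polynomial.C_mul, Polynomial.coeff_C_mul_X_pow]

theorem isHomogeneous_coeff_aeval_fiber {p : PlaneRing K} {n : ℕ} (hp : p.IsHomogeneous n)
    (k : ℕ) : ((aeval ![Polynomial.C (X 1 : MvPolynomial (Fin 3) K), Polynomial.C (X 0),
      Polynomial.X] p).coeff k).IsHomogeneous (n - k) := by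
  rw [coeff_aeval_fiber]
  refine IsHomogeneous.sum _ _ _ fun m hm => ?_
  have := degree_eq_of_mem_support hp hm
  split_ifs with hk
  · rw [show n - k = m 0 + m 1 by omega]
    exact ((isHomogeneous_X_pow _ _).mul (isHomogeneous_X_pow _ _)).C_mul _
  · exact isHomogeneous_zero _ _ _

theorem IsHilbertBurch.isBirational_of_natDegree (h : IsHilbertBurch f d 1 μ₂ φ) (hd : 3 ≤ d)
    (hf : ∀ i, (f i).IsHomogeneous d) (hdom : IsDominant f) (hφ : IsNormalForm φ)
    (hdeg : (fiberPolynomial φ).natDegree = 1) : IsBirational f := by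
  obtain ⟨h0, h1, h2⟩ := hφ
  have hμ := h.sum_eq
  set α := (fiberPolynomial φ).coeff 1 with hα
  set β := (fiberPolynomial φ).coeff 0 with hβ
  have hα0 : α ≠ 0 := by
    rw [hα, ← hdeg]
    refine Polynomial.leadingCoeff_ne_zero.2 fun h0 => ?_
    rw [h0, Polynomial.natDegree_zero] at hdeg
    omega
  have hhom (k : ℕ) (hk : k ≤ μ₂) : ((fiberPolynomial φ).coeff k).IsHomogeneous (d - k) := by
    rw [fiberPolynomial, Polynomial.finsetSum_coeff]
    refine IsHomogeneous.sum _ _ _ fun i _ => ?_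
    rw [Polynomial.coeff_C_mul, show d - k = 1 + (μ₂ - k) by omega]
    exact (isHomogeneous_X _ _).mul (isHomogeneous_coeff_aeval_fiber (h.homogeneous₂ i) k)
  have e0 := h.sum_mul_col 0
  have e1 := h.sum_mul_col 1
  simp only [Fin.sum_univ_three, h0, h1, h2, mul_zero, add_zero] at e0
  -- The linear syzygy `f₀ x₀ = f₁ x₁` gives `f₀ = η x₁` and `f₁ = η x₀`.
  obtain ⟨η, hη⟩ := ((X_prime (i := (1 : Fin 3))).dvd_or_dvd (⟨f 1, by linear_combination e0⟩ :
    X 1 ∣ f 0 * X 0)).resolve_right (by simp [X_dvd_X])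
  have hη1 : f 1 = η * X 0 :=
    mul_right_cancel₀ (X_ne_zero (1 : Fin 3)) (by rw [hη] at e0; linear_combination -e0)
  have hη0 : η ≠ 0 := fun h00 => hdom.ne_zero 0 (by rw [hη, h00, mul_zero])
  -- At `y = f`, `s = η x₂` the parametrized point is `η • (x₀, x₁, x₂)`, where the second equation
  -- vanishes by the second syzygy.
  have hlin : aeval f α * (η * X 2) + aeval f β = 0 := by
    have hG : fiberPolynomial φ = Polynomial.C α * Polynomial.X + Polynomial.C β :=
      Polynomial.eq_X_add_C_of_natDegree_le_one hdeg.le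
    have hev := congrArg (Polynomial.eval₂ (aeval (R := K) f).toRingHom (η * X 2)) hG
    have hq (q : PlaneRing K) : Polynomial.eval₂ (aeval (R := K) f).toRingHom (η * X 2)
        (aeval ![Polynomial.C (X 1), Polynomial.C (X 0), Polynomial.X] q) =
        aeval (fun j => η * X j) q := by
      induction q using MvPolynomial.induction_on with
      | C a =>
        rw [algHom_C, algHom_C, IsScalarTower.algebraMap_apply K (MvPolynomial (Fin 3) K)
          (Polynomial _), Polynomial.algebraMap_eq, Polynomial.eval₂_C]
        exact (aeval (R := K) f).commutes a
      | add p q hp hq => rw [map_add, map_add, Polynomial.eval₂_add, hp, hq]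
      | mul_X p i hp =>
        rw [map_mul, map_mul, Polynomial.eval₂_mul, hp, aeval_X, aeval_X]
        congr 1
        fin_cases i
        · simp [hη1]
        · simp [hη, mul_comm]
        · simp
    simp only [fiberPolynomial, Polynomial.eval₂_finsetSum, Polynomial.eval₂_mul,
      Polynomial.eval₂_C, Polynomial.eval₂_add, Polynomial.eval₂_X, hq,
      aeval_mul_of_isHomogeneous (h.homogeneous₂ _), aeval_X_left_apply] at hev
    refine Eq.trans hev.symm ?_
    have hX (i : Fin 3) : (aeval (R := K) f).toRingHom (X i) = f i := aeval_X f i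
    simp only [hX, mul_left_comm (f _)]
    rw [← Finset.mul_sum, e1, mul_zero]
  -- The inverse is the point `(y₁, y₀, s)` at the root `s = -β / α`, cleared of denominators.
  refine hdom.isBirational hf (e := d) (g := ![X 1 * α, X 0 * α, -β]) (D := η * aeval f α)
    (fun j => ?_) (mul_ne_zero hη0 fun h00 => hα0 (hdom (by rw [h00, map_zero]))) fun j => ?_
  · have hα1 := hhom 1 (by omega)
    have hβ1 := hhom 0 (by omega)
    fin_cases j
    · have := (isHomogeneous_X K (1 : Fin 3)).mul hα1
      rwa [show 1 + (d - 1) = d by omega] at this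
    · have := (isHomogeneous_X K (0 : Fin 3)).mul hα1
      rwa [show 1 + (d - 1) = d by omega] at this
    · exact hβ1.neg
  · fin_cases j
    · simp [hη1]; ring
    · simp [hη]; ring
    · change aeval f (-β) = η * aeval f α * X 2
      rw [map_neg]
      linear_combination -hlin

end

/-! ### Heights of ideals of variables -/

section heights

variable {K : Type*} [Field K]

/-- The ideal is the kernel of the substitution that sets the variables in `s` to zero. -/
theorem isPrime_span_X_image (s : Set (Fin 3)) :
    (Ideal.span (X '' s) : Ideal (PlaneRing K)).IsPrime := by
  classical
  let θ : PlaneRing K →ₐ[K] PlaneRing K := aeval fun i => if i ∈ s then 0 else X i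
  have hker : Ideal.span (X '' s) = RingHom.ker θ.toRingHom := by
    refine le_antisymm (Ideal.span_le.2 ?_) fun p hp => ?_
    · rintro _ ⟨i, hi, rfl⟩
      change θ (X i) = 0
      simp [θ, hi]
    · have hmod : Ideal.Quotient.mk (Ideal.span (X '' s)) (θ p) =
          Ideal.Quotient.mk (Ideal.span (X '' s)) p := by
        have : (Ideal.Quotient.mkₐ K (Ideal.span (X '' s))).comp θ =
            Ideal.Quotient.mkₐ K (Ideal.span (X '' s)) := by
          ext1 i
          by_cases hi : i ∈ s
          · have : Ideal.Quotient.mk (Ideal.span (X '' s)) (X i : PlaneRing K) = 0 :=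
              Ideal.Quotient.eq_zero_iff_mem.2 (Ideal.subset_span ⟨i, hi, rfl⟩)
            simp [θ, hi, this]
          · simp [θ, hi]
        exact congrFun (congrArg DFunLike.coe this) p
      have hp0 : θ p = 0 := hp
      rw [hp0, map_zero] at hmod
      exact Ideal.Quotient.eq_zero_iff_mem.1 hmod.symm
  rw [hker]
  exact RingHom.ker_isPrime _

theorem height_span_X_image_add_one_le {s t : Set (Fin 3)} (hst : s ⊆ t) {i : Fin 3} (hi : i ∈ t)
    (his : i ∉ s) : (Ideal.span (X '' s) : Ideal (PlaneRing K)).height + 1 ≤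
      (Ideal.span (X '' t) : Ideal (PlaneRing K)).height := by
  have := isPrime_span_X_image (K := K) s
  have := isPrime_span_X_image (K := K) t
  refine Ideal.height_add_one_le_of_lt_of_isPrime
    (lt_of_le_of_ne (Ideal.span_mono (Set.image_mono hst)) fun heq => ?_)
  have hmem : (X i : PlaneRing K) ∈ Ideal.span (X '' s) := by
    rw [heq]
    exact Ideal.subset_span ⟨i, hi, rfl⟩
  obtain ⟨j, hj, hne⟩ := mem_ideal_span_X_image.1 hmem (Finsupp.single i 1) (by simp [support_X])
  have : i = j := by
    by_contra hij
    exact hne (Finsupp.single_eq_of_ne' hij)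
  exact his (this ▸ hj)

theorem two_le_height_span_X :
    2 ≤ (Ideal.span (X '' {0, 1}) : Ideal (PlaneRing K)).height := by
  have h1 := height_span_X_image_add_one_le (K := K) (s := ∅) (t := {0}) (by simp) (i := 0)
    (by simp) (by simp)
  have h2 := height_span_X_image_add_one_le (K := K) (s := {0}) (t := {0, 1}) (by simp) (i := 1)
    (by simp) (by simp)
  refine le_trans ?_ ((add_le_add_left (le_trans (le_add_self : (1 : ℕ∞) ≤ _) h1) 1).trans h2)
  norm_num

theorem height_span_X_le_two :
    (Ideal.span (X '' {0, 1}) : Ideal (PlaneRing K)).height ≤ 2 := by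
  have hp := isPrime_span_X_image (K := K) {0, 1}
  have := Ideal.height_le_card_of_mem_minimalPrimes_span (R := PlaneRing K)
    (p := Ideal.span (X '' {0, 1})) (s := X '' {0, 1}) (Set.toFinite _)
    (by rw [Ideal.minimalPrimes_eq_subsingleton_self]; simp)
  refine this.trans ?_
  have h2 := (Set.ncard_image_le (f := (X : Fin 3 → PlaneRing K)) (Set.toFinite {0, 1})).trans
    (Set.ncard_pair (zero_ne_one' (Fin 3))).le
  exact_mod_cast h2

theorem height_entryIdeal_ne_two {φ : Matrix (Fin 3) (Fin 2) (PlaneRing K)}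
    (hcol : ∀ i, φ i 0 = X i) : (entryIdeal φ).height ≠ 2 := by
  have h1 := height_span_X_image_add_one_le (K := K) (s := {0, 1}) (t := Set.univ) (by simp)
    (i := 2) (by simp) (by simp)
  have h2 : Ideal.span (X '' Set.univ) ≤ entryIdeal φ := by
    refine Ideal.span_le.2 ?_
    rintro _ ⟨i, -, rfl⟩
    exact Ideal.subset_span ⟨(i, 0), hcol i⟩
  intro h3
  have h4 := (add_le_add_left two_le_height_span_X 1).trans (h1.trans (Ideal.height_mono h2))
  rw [h3] at h4
  norm_num at h4

end heights

/-! ### Sylvester steps as the order of vanishing in `t` -/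

section sylvester

variable {K : Type*} [Field K] {d μ₂ : ℕ} {f : Fin 3 → PlaneRing K}
  {φ : Matrix (Fin 3) (Fin 2) (PlaneRing K)}

/-- The point `(t y₁, t y₀, s)` with coordinates in `K[y₀, y₁, y₂][s][t]`. -/
noncomputable def blowupPoint (K : Type*) [Field K] :
    Fin 3 → Polynomial (Polynomial (MvPolynomial (Fin 3) K)) :=
  ![Polynomial.X * Polynomial.C (Polynomial.C (X 1)),
    Polynomial.X * Polynomial.C (Polynomial.C (X 0)), Polynomial.C Polynomial.X]

/-- The substitution `x₀ ↦ t y₁`, `x₁ ↦ t y₀`, `x₂ ↦ s`, with values in `K[y₀, y₁, y₂][s][t]`. -/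
noncomputable def blowup (K : Type*) [Field K] :
    BiRing K →+* Polynomial (Polynomial (MvPolynomial (Fin 3) K)) :=
  eval₂Hom (aeval (R := K) (blowupPoint K)).toRingHom fun i => Polynomial.C (Polynomial.C (X i))

theorem blowup_C (q : PlaneRing K) : blowup K (C q) = aeval (blowupPoint K) q :=
  eval₂Hom_C _ _ q

theorem blowup_X (i : Fin 3) : blowup K (X i) = Polynomial.C (Polynomial.C (X i)) :=
  eval₂Hom_X' _ _ i

/-- Setting `t = 0` and then sending `s` back to `x₂` recovers the class modulo `(x₀, x₁)`. -/
theorem mem_axisIdeal_iff (F : BiRing K) : F ∈ axisIdeal K ↔ Polynomial.X ∣ blowup K F := by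
  constructor
  · intro hF
    obtain ⟨a, b, rfl⟩ := Ideal.mem_span_pair.1 hF
    rw [map_add, map_mul, map_mul, blowup_C, blowup_C, aeval_X, aeval_X]
    exact dvd_add
      (Dvd.dvd.mul_left (Dvd.intro (Polynomial.C (Polynomial.C (X 1))) rfl) _)
      (Dvd.dvd.mul_left (Dvd.intro (Polynomial.C (Polynomial.C (X 0))) rfl) _)
  · rw [Polynomial.X_dvd_iff]
    intro hF
    let r : Polynomial (MvPolynomial (Fin 3) K) →+* BiRing K ⧸ axisIdeal K :=
      (Ideal.Quotient.mk _).comp (Polynomial.eval₂RingHom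
        (eval₂Hom ((C : PlaneRing K →+* BiRing K).comp C) X) (C (X 2)))
    have hr : (r.comp Polynomial.constantCoeff).comp (blowup K) =
        Ideal.Quotient.mk (axisIdeal K) := by
      apply MvPolynomial.ringHom_ext
      · intro q
        have h0 : ((r.comp Polynomial.constantCoeff).comp (blowup K)).comp C =
            (Ideal.Quotient.mk (axisIdeal K)).comp C := by
          apply MvPolynomial.ringHom_ext
          · intro c
            have : blowup K (C (C c)) = Polynomial.C (Polynomial.C (C c)) := by
              rw [blowup_C]
              exact AlgHom.commutes _ c
            simp [this, r]
          · intro i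
            have hm (j : Fin 3) (hj : j = 0 ∨ j = 1) :
                Ideal.Quotient.mk (axisIdeal K) (C (X j)) = 0 := by
              refine Ideal.Quotient.eq_zero_iff_mem.2 (Ideal.subset_span ?_)
              rcases hj with rfl | rfl <;> simp
            fin_cases i
            · simp [blowup_C, blowupPoint, hm]
            · simp [blowup_C, blowupPoint, hm]
            · simp [blowup_C, blowupPoint, r]
        exact congrFun (congrArg DFunLike.coe h0) q
      · intro i
        simp [blowup_X, r]
    rw [← Ideal.Quotient.eq_zero_iff_mem, ← hr]
    simp [hF]

/-- The determinant is `a y₁ + b y₀`, so a step is division by `t`, whatever `a` and `b` are. -/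
theorem blowup_eq_X_mul {F a b : BiRing K} (hF : F = a * C (X 0) + b * C (X 1)) :
    blowup K F = Polynomial.X * blowup K (Matrix.det !![X 0, -X 1; a, b]) := by
  rw [hF, Matrix.det_fin_two_of]
  simp only [map_add, map_sub, map_mul, map_neg, blowup_C, blowup_X, aeval_X, blowupPoint,
    cons_val]
  ring

theorem IsSylvesterRun.blowup_eq {F : ℕ → BiRing K} {m : ℕ} (h : IsSylvesterRun φ F m) {i : ℕ}
    (hi : i ≤ m) : blowup K (secondEquation φ) = Polynomial.X ^ i * blowup K (F i) := by
  induction i with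
  | zero => rw [h.1]; simp
  | succ i ih =>
    obtain ⟨a, b, hab, hnext⟩ := h.2.1 i hi
    rw [ih (by omega), hnext, blowup_eq_X_mul hab, pow_succ, mul_assoc]

/-- The number of steps of the algorithm is the order in `t` of the second equation after the
substitution `x₀ ↦ t y₁`, `x₁ ↦ t y₀`. -/
theorem sylvesterSteps_iff (m : ℕ) : SylvesterSteps φ m ↔
    Polynomial.X ^ m ∣ blowup K (secondEquation φ) ∧
      ¬ Polynomial.X ^ (m + 1) ∣ blowup K (secondEquation φ) := by
  have hrun {F : ℕ → BiRing K} {n : ℕ} (h : IsSylvesterRun φ F n) :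
      Polynomial.X ^ n ∣ blowup K (secondEquation φ) ∧
      ¬ Polynomial.X ^ (n + 1) ∣ blowup K (secondEquation φ) := by
    rw [h.blowup_eq le_rfl]
    refine ⟨Dvd.intro _ rfl, fun hd => h.2.2 ((mem_axisIdeal_iff _).2 ?_)⟩
    rw [pow_succ] at hd
    exact (mul_dvd_mul_iff_left (pow_ne_zero n Polynomial.X_ne_zero)).1 hd
  constructor
  · rintro ⟨⟨F, hF⟩, -⟩
    exact hrun hF
  · rintro ⟨hm, hm'⟩
    refine ⟨?_, fun F n hF => ?_⟩
    · have hnext (F : BiRing K) : ∃ F', F ∈ axisIdeal K → ∃ a b : BiRing K,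
          F = a * C (X 0) + b * C (X 1) ∧ F' = Matrix.det !![X 0, -X 1; a, b] := by
        by_cases hF : F ∈ axisIdeal K
        · obtain ⟨a, b, hab⟩ := Ideal.mem_span_pair.1 hF
          exact ⟨_, fun _ => ⟨a, b, hab.symm, rfl⟩⟩
        · exact ⟨0, fun h => absurd h hF⟩
      choose next hnext using hnext
      let F : ℕ → BiRing K := fun i => next^[i] (secondEquation φ)
      have hsucc (i : ℕ) : F (i + 1) = next (F i) := Function.iterate_succ_apply' _ _ _
      have hmem {i : ℕ} (hi : i < m)
          (hFi : blowup K (secondEquation φ) = Polynomial.X ^ i * blowup K (F i)) :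
          F i ∈ axisIdeal K := by
        rw [mem_axisIdeal_iff]
        have h1 := (pow_dvd_pow Polynomial.X hi).trans hm
        rw [hFi, pow_succ] at h1
        exact (mul_dvd_mul_iff_left (pow_ne_zero i Polynomial.X_ne_zero)).1 h1
      have hF (i : ℕ) (hi : i ≤ m) :
          blowup K (secondEquation φ) = Polynomial.X ^ i * blowup K (F i) := by
        induction i with
        | zero => simp [F]
        | succ i ih =>
          have hFi := ih (by omega)
          obtain ⟨a, b, hab, hn⟩ := hnext (F i) (hmem hi hFi)
          rw [hsucc, hn, hFi, blowup_eq_X_mul hab, pow_succ, mul_assoc]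
      refine ⟨F, rfl, fun i hi => ?_, fun hmF => hm' ?_⟩
      · rw [hsucc]
        exact hnext (F i) (hmem hi (hF i hi.le))
      · rw [hF m le_rfl, pow_succ]
        exact mul_dvd_mul_left _ ((mem_axisIdeal_iff _).1 hmF)
    · obtain ⟨hn, hn'⟩ := hrun hF
      by_contra hne
      rcases Nat.lt_or_gt_of_ne hne with hlt | hlt
      · exact hn' ((pow_dvd_pow _ hlt).trans hm)
      · exact hm' ((pow_dvd_pow _ hlt).trans hn)

/-- In degree `n`, order `k` in `x₀, x₁` means exponent `n - k` of `x₂`: low order in `t`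
corresponds to high degree in `s`. -/
theorem coeff_aeval_blowup {p : PlaneRing K} {n : ℕ} (hp : p.IsHomogeneous n) {k : ℕ}
    (hk : k ≤ n) :
    (aeval (blowupPoint K) p).coeff k =
    Polynomial.C ((aeval ![Polynomial.C (X 1 : MvPolynomial (Fin 3) K), Polynomial.C (X 0),
      Polynomial.X] p).coeff (n - k)) * Polynomial.X ^ (n - k) := by
  rw [coeff_aeval_fiber, blowupPoint, aeval_fiber_eq_sum, Polynomial.finsetSum_coeff, map_sum, Finset.sum_mul]
  refine Finset.sum_congr rfl fun m hm => ?_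
  have hn := degree_eq_of_mem_support hp hm
  have h1 : algebraMap K (Polynomial (Polynomial (MvPolynomial (Fin 3) K))) (coeff m p) *
      ((Polynomial.X * Polynomial.C (Polynomial.C (X 1))) ^ m 0 *
        (Polynomial.X * Polynomial.C (Polynomial.C (X 0))) ^ m 1 *
        Polynomial.C Polynomial.X ^ m 2) =
      Polynomial.C (Polynomial.C (C (coeff m p) * (X 1 ^ m 0 * X 0 ^ m 1)) *
        Polynomial.X ^ m 2) * Polynomial.X ^ (m 0 + m 1) := by
    have : algebraMap K (Polynomial (Polynomial (MvPolynomial (Fin 3) K))) (coeff m p) =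
      Polynomial.C (Polynomial.C (C (coeff m p))) := rfl
    rw [this]
    simp only [map_mul, map_pow]
    ring
  rw [h1, Polynomial.coeff_C_mul_X_pow]
  by_cases hkm : k = m 0 + m 1
  · rw [if_pos hkm, if_pos (by omega), show n - k = m 2 by omega]
  · rw [if_neg hkm, if_neg (by omega), map_zero, zero_mul]

theorem coeff_blowup_secondEquation (hp : ∀ i, (φ i 1).IsHomogeneous μ₂) {k : ℕ} (hk : k ≤ μ₂) :
    (blowup K (secondEquation φ)).coeff k =
      Polynomial.C ((fiberPolynomial φ).coeff (μ₂ - k)) * Polynomial.X ^ (μ₂ - k) := by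
  simp only [secondEquation, fiberPolynomial, map_sum, map_mul, blowup_X, blowup_C,
    Polynomial.finsetSum_coeff, Polynomial.coeff_C_mul, coeff_aeval_blowup (hp _) hk,
    Finset.sum_mul, mul_assoc]

theorem natDegree_fiberPolynomial_le (hp : ∀ i, (φ i 1).IsHomogeneous μ₂) :
    (fiberPolynomial φ).natDegree ≤ μ₂ := by
  refine Polynomial.natDegree_le_iff_coeff_eq_zero.2 fun k hk => ?_
  simp only [fiberPolynomial, Polynomial.finsetSum_coeff, Polynomial.coeff_C_mul,
    coeff_aeval_fiber]
  refine Finset.sum_eq_zero fun i _ => ?_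
  rw [Finset.sum_eq_zero, mul_zero]
  intro m hm
  have := degree_eq_of_mem_support (hp i) hm
  rw [if_neg (by omega)]

theorem sylvesterSteps_iff_natDegree (hp : ∀ i, (φ i 1).IsHomogeneous μ₂) (hμ : 1 ≤ μ₂) :
    SylvesterSteps φ (μ₂ - 1) ↔ (fiberPolynomial φ).natDegree = 1 := by
  have hcoeff {k : ℕ} (hk : k ≤ μ₂) : (blowup K (secondEquation φ)).coeff k = 0 ↔
      (fiberPolynomial φ).coeff (μ₂ - k) = 0 := by
    rw [coeff_blowup_secondEquation hp hk, mul_eq_zero, Polynomial.C_eq_zero]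
    simp [Polynomial.X_ne_zero]
  rw [sylvesterSteps_iff, Polynomial.X_pow_dvd_iff, Polynomial.X_pow_dvd_iff]
  constructor
  · rintro ⟨h1, h2⟩
    push Not at h2
    obtain ⟨k, hk, hk0⟩ := h2
    have hk1 : k = μ₂ - 1 := by
      by_contra hne
      exact hk0 (h1 k (by omega))
    rw [Ne, hcoeff (by omega), hk1, show μ₂ - (μ₂ - 1) = 1 by omega] at hk0
    refine le_antisymm (Polynomial.natDegree_le_iff_coeff_eq_zero.2 fun j hj => ?_)
      (Polynomial.le_natDegree_of_ne_zero hk0)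
    by_cases hjμ : j ≤ μ₂
    · have := (hcoeff (k := μ₂ - j) (by omega)).1 (h1 _ (by omega))
      rwa [show μ₂ - (μ₂ - j) = j by omega] at this
    · exact Polynomial.coeff_eq_zero_of_natDegree_lt
        ((natDegree_fiberPolynomial_le hp).trans_lt (by omega))
  · intro h1
    refine ⟨fun k hk => (hcoeff (by omega)).2
      (Polynomial.coeff_eq_zero_of_natDegree_lt (by omega)), fun h2 => ?_⟩
    have h3 := (hcoeff (by omega)).1 (h2 (μ₂ - 1) (by omega))
    rw [show μ₂ - (μ₂ - 1) = (fiberPolynomial φ).natDegree by omega] at h3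
    have h4 := Polynomial.leadingCoeff_eq_zero.1 h3
    rw [h4, Polynomial.natDegree_zero] at h1
    omega

/-- Degree one is below `μ₂`, so the second equation lies in `(x₀, x₁)`. Its coefficients in `y` are
the `p_i`, so the entries generate exactly `(x₀, x₁)`. -/
theorem IsNormalForm.height_entryIdeal (hφ : IsNormalForm φ)
    (hp : ∀ i, (φ i 1).IsHomogeneous μ₂) (hμ : 2 ≤ μ₂)
    (hdeg : (fiberPolynomial φ).natDegree = 1) : (entryIdeal φ).height = 2 := by
  obtain ⟨h0, h1, h2⟩ := hφ
  have hmem : secondEquation φ ∈ axisIdeal K := by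
    rw [mem_axisIdeal_iff, Polynomial.X_dvd_iff, coeff_blowup_secondEquation hp (Nat.zero_le _),
      Polynomial.coeff_eq_zero_of_natDegree_lt (by omega)]
    simp
  have haxis : axisIdeal K = Ideal.map C (Ideal.span (X '' {0, 1}) : Ideal (PlaneRing K)) := by
    rw [Ideal.map_span, ← Set.image_comp]
    simp [axisIdeal, Set.image_pair]
  rw [haxis, mem_map_C_iff] at hmem
  have hp1 (i : Fin 3) : φ i 1 ∈ (Ideal.span (X '' {0, 1}) : Ideal (PlaneRing K)) := by
    have := hmem (Finsupp.single i 1)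
    simpa [secondEquation, coeff_sum, coeff_X_mul', coeff_C, Finsupp.single_apply,
      Finset.sum_ite_eq] using this
  have hX (j : Fin 3) (hj : j = 0 ∨ j = 1) :
      X j ∈ (Ideal.span (X '' {0, 1}) : Ideal (PlaneRing K)) :=
    Ideal.subset_span ⟨j, hj, rfl⟩
  have heq : entryIdeal φ = Ideal.span (X '' {0, 1}) := by
    refine le_antisymm (Ideal.span_le.2 ?_) (Ideal.span_le.2 ?_)
    · rintro _ ⟨⟨i, k⟩, rfl⟩
      fin_cases k
      · fin_cases i
        · simp [h0, hX]
        · simp [h1, hX]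
        · simp [h2]
      · exact hp1 i
    · rintro _ ⟨j, rfl | rfl, rfl⟩
      · exact Ideal.subset_span ⟨(0, 0), h0⟩
      · have : φ 1 0 ∈ entryIdeal φ := Ideal.subset_span ⟨(1, 0), rfl⟩
        rw [h1] at this
        exact neg_mem_iff.1 this
  rw [heq]
  exact le_antisymm height_span_X_le_two two_le_height_span_X

end sylvester

end PlaneMap

/-! ### The equivalence -/

/-- The last condition is stated both for some and for every linear change of coordinates that
brings the first column of `φ` to the form `(x₀, -x₁, 0)`. -/
theorem mainTheorem12 {K : Type*} [Field K] (d μ₁ μ₂ : ℕ) (hd : 3 ≤ d)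
    (f : Fin 3 → PlaneRing K) (hf : ∀ i, (f i).IsHomogeneous d)
    (hdom : PlaneMap.IsDominant f)
    (hdim : ringKrullDim (PlaneRing K ⧸ PlaneMap.baseIdeal f) = 1)
    (hsat : PlaneMap.IsSaturated (PlaneMap.baseIdeal f))
    (φ : Matrix (Fin 3) (Fin 2) (PlaneRing K))
    (hφ : PlaneMap.IsHilbertBurch f d μ₁ μ₂ φ) (hμ : μ₁ = 1) :
    (PlaneMap.IsBirational f ↔
      (PlaneMap.entryIdeal φ).height = 2 ∧
        ∃ A P : GL (Fin 3) K, PlaneMap.IsNormalForm (PlaneMap.changeCoords A P φ) ∧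
          PlaneMap.SylvesterSteps (PlaneMap.changeCoords A P φ) (d - 2)) ∧
    (PlaneMap.IsBirational f ↔
      (PlaneMap.entryIdeal φ).height = 2 ∧
        ∀ A P : GL (Fin 3) K, PlaneMap.IsNormalForm (PlaneMap.changeCoords A P φ) →
          PlaneMap.SylvesterSteps (PlaneMap.changeCoords A P φ) (d - 2)) := by
  subst hμ
  have hμ₂ := hφ.sum_eq
  have hsteps : d - 2 = μ₂ - 1 := by omega
  have key (A P : GL (Fin 3) K)
      (hN : PlaneMap.IsNormalForm (PlaneMap.changeCoords A P φ)) :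
      PlaneMap.IsBirational f ↔
        PlaneMap.SylvesterSteps (PlaneMap.changeCoords A P φ) (d - 2) := by
    have h' := hφ.comp_linear A P
    have hf' := PlaneMap.isHomogeneous_changeForms hf A (PlaneMap.dual P)
    have hdom' := hdom.comp_linear A (PlaneMap.dual P)
    rw [hsteps, PlaneMap.sylvesterSteps_iff_natDegree h'.homogeneous₂ (by omega)]
    refine ⟨fun hbir => h'.natDegree_fiberPolynomial hf' hN (hbir.comp_linear hf _ _),
      fun hdeg => ?_⟩
    have h1 := (h'.isBirational_of_natDegree hd hf' hdom' hN hdeg).comp_linear hf'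
      A⁻¹ (PlaneMap.dual P)⁻¹
    rwa [PlaneMap.changeForms_inv] at h1
  have hheight (A P : GL (Fin 3) K)
      (hN : PlaneMap.IsNormalForm (PlaneMap.changeCoords A P φ)) (hbir : PlaneMap.IsBirational f) :
      (PlaneMap.entryIdeal φ).height = 2 := by
    have h' := hφ.comp_linear A P
    rw [← PlaneMap.height_entryIdeal_changeCoords A P]
    exact hN.height_entryIdeal h'.homogeneous₂ (by omega)
      (h'.natDegree_fiberPolynomial (PlaneMap.isHomogeneous_changeForms hf _ _) hN
        (hbir.comp_linear hf _ _))
  obtain ⟨A, P, hcol | hN⟩ := hφ.exists_changeCoords hdom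
  · have hnot : ¬ PlaneMap.IsBirational f := fun hbir =>
      (hφ.comp_linear A P).not_isBirational hd (PlaneMap.isHomogeneous_changeForms hf _ _) hcol
        (hbir.comp_linear hf _ _)
    have hne : (PlaneMap.entryIdeal φ).height ≠ 2 := by
      rw [← PlaneMap.height_entryIdeal_changeCoords A P]
      exact PlaneMap.height_entryIdeal_ne_two hcol
    exact ⟨iff_of_false hnot fun h => hne h.1, iff_of_false hnot fun h => hne h.1⟩
  · exact ⟨⟨fun h => ⟨hheight A P hN h, A, P, hN, (key A P hN).1 h⟩,
      fun ⟨_, A', P', hN', hs⟩ => (key A' P' hN').2 hs⟩,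
      ⟨fun h => ⟨hheight A P hN h, fun A' P' hN' => (key A' P' hN').1 h⟩,
      fun ⟨_, hall⟩ => (key A P hN).2 (hall A P hN)⟩⟩
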